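/- Let $T>0$, let $f\in C^\infty([0,T])$ be positive, and let $M=[0,T]\times S^1$ carry the metric $dt^2+f(t)^2\,d\theta^2$ and one of its two spin structures; the allowed Fourier modes are $\mathcal K=\mathbb Z$ (periodic) or $\mathcal K=\mathbb Z+\tfrac12$ (anti-periodic). Let $A\in\mathbb R$, and let $D=i(\gamma_1\nabla_{e_1}+\gamma_2\nabla_{e_2})$, with $\gamma_1=\sigma_1,\ \gamma_2=\sigma_2$ (Pauli matrices), $\nabla_{e_1}=\partial_t$ and $\nabla_{e_2}=\tfrac1f(\partial_\theta+iA)-\tfrac{f'}{2f}\gamma_1\gamma_2$, be the Dirac operator coupled to the constant connection $d+iA\,d\theta$. With $S^+$ the lower and $S^-$ the upper spinor component, its chiral part is $$D^+=i\Bigl(\partial_t+\frac{f'}{2f}+\frac1f(-i\partial_\theta+A)\Bigr):H^1(M;S^+)\to L^2(M;S^-).$$ For a choice of unit normal $N=\pm\partial_t$ on each boundary component $Y_{t_0}=\{t_0\}\times S^1$, $t_0\in\{0,T\}$, let $B_{t_0}^+$ be the restriction to $S^+$ of $-i\gamma(N)\gamma_2\cdot\frac1{f(t_0)}(-i\partial_\theta+A)$,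 with domain $H^1(Y_{t_0};S^+)$ in $L^2(Y_{t_0};S^+)$. Thus $B_0^+=-\frac1{f(0)}(-i\partial_\theta+A)$ and $B_T^+=\frac1{f(T)}(-i\partial_\theta+A)$ for the inward normal, and both change sign for the outward normal. Let $\xi(B)=\frac12(\eta(B,0)+\dim\ker B)$, where $\eta(B,0)$ is the value at $s=0$ of the meromorphic continuation of $\sum_{\mu\in\mathrm{Spec}(B)\setminus\{0\}}\operatorname{sign}(\mu)|\mu|^{-s}$ (eigenvalues counted with multiplicity), and let $D^+_{\mathrm{APS}}$ be the restriction of $D^+$ to $$\{\psi\in H^1(M;S^+):P_{>0}(B_0^+)(\psi|_{t=0})=0,\ P_{>0}(B_T^+)(\psi|_{t=T})=0\},$$ where $P_{>0}(B)$ is the orthogonal projection onto the closed span of the eigenspaces of $B$ with positive eigenvalue. Assume that $k+A\neq0$ for every $k\in\mathcal K$. Then, for the inward as well as for the outward normal: 1. $B_0^+$ and $B_T^+$ are invertible (bijective from their domains onto $L^2$, with bounded inverse); 2. the $\eta$-series of $B_0^+$ and $B_T^+$ converge for $\operatorname{Re}s$ large and have meromorphic continuations to $\mathbb C$ that are regular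 at $0$, and $\xi(B_0^+)+\xi(B_T^+)=0$; 3. the index $\dim\ker D^+_{\mathrm{APS}}-\dim\ker (D^+_{\mathrm{APS}})^*$ vanishes, both dimensions being finite. Moreover, for the outward normal, that is, when the spectral projections are those of $\frac1{f(0)}(-i\partial_\theta+A)$ at $t=0$ and of $-\frac1{f(T)}(-i\partial_\theta+A)$ at $t=T$, the operator $D^+_{\mathrm{APS}}$ is Fredholm from its domain with the $H^1$-norm to $L^2(M;S^-)$, and its index $\dim\ker-\dim\operatorname{coker}$ is $0$. -/

import Mathlib

open MeasureTheory Set Complex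
open scoped ContDiff

noncomputable section

/-! ## Auxiliary facts on `L²` spaces -/

namespace LpAux

variable {α : Type*} [MeasurableSpace α] {μ ν : Measure α} {C : ENNReal}

theorem integrable_mul (hC : C ≠ ⊤) (hν : ν ≤ C • μ) (u : Lp ℂ 2 μ) {φ : α → ℂ}
    (hφ : MemLp φ 2 ν) : Integrable (fun x => u x * φ x) ν :=
  MemLp.integrable_mul ((Lp.memLp u).of_measure_le_smul hC hν) hφ

theorem integral_add_mul (hC : C ≠ ⊤) (hν : ν ≤ C • μ) (u v : Lp ℂ 2 μ) {φ : α → ℂ}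
    (hφ : MemLp φ 2 ν) :
    ∫ x, (u + v : Lp ℂ 2 μ) x * φ x ∂ν = (∫ x, u x * φ x ∂ν) + ∫ x, v x * φ x ∂ν := by
  rw [← integral_add (integrable_mul hC hν u hφ) (integrable_mul hC hν v hφ)]
  refine integral_congr_ae ?_
  filter_upwards [(Measure.absolutelyContinuous_of_le_smul hν).ae_le (Lp.coeFn_add u v)]
    with x hx
  rw [hx, Pi.add_apply, add_mul]

theorem integral_smul_mul (hν : ν ≤ C • μ) (c : ℂ) (u : Lp ℂ 2 μ) (φ : α → ℂ) :
    ∫ x, (c • u : Lp ℂ 2 μ) x * φ x ∂ν = c * ∫ x, u x * φ x ∂ν := by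
  rw [← integral_const_mul]
  refine integral_congr_ae ?_
  filter_upwards [(Measure.absolutelyContinuous_of_le_smul hν).ae_le (Lp.coeFn_smul c u)]
    with x hx
  rw [hx, Pi.smul_apply, smul_eq_mul, mul_assoc]

theorem integral_zero_mul (hν : ν ≤ C • μ) (φ : α → ℂ) :
    ∫ x, (0 : Lp ℂ 2 μ) x * φ x ∂ν = 0 := by
  simpa using integral_smul_mul hν 0 (0 : Lp ℂ 2 μ) φ

end LpAux

/-! ## The geometry -/

/-- The warped cylinder `[0,T] × S¹` with metric `dt² + f(t)² dθ²`. -/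
structure WarpedCylinder where
  T : ℝ
  T_pos : 0 < T
  f : ℝ → ℝ
  f_smooth : ContDiffOn ℝ ∞ f (Icc 0 T)
  f_pos : ∀ t ∈ Icc 0 T, 0 < f t

/-- The two spin structures on the cylinder. -/
inductive SpinStructure
  | periodic
  | antiperiodic

/-- The two boundary components `{0} × S¹` and `{T} × S¹`. -/
inductive Endpoint
  | left
  | right

/-- The two choices of a unit normal field along the boundary. The choice fixes the global sign of
the endpoint operators and hence which half of their spectrum enters the spectral projections. -/
inductive NormalConvention
  | inward
  | outward

namespace SpinStructure

/-- The holonomy of sections around the circle. -/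
def hol : SpinStructure → ℂ
  | periodic => 1
  | antiperiodic => -1

/-- The allowed Fourier modes: `ℤ`, respectively `ℤ + 1/2`. -/
def modes : SpinStructure → Set ℝ
  | periodic => {k | ∃ n : ℤ, k = n}
  | antiperiodic => {k | ∃ n : ℤ, k = n + 1 / 2}

/-- Smooth sections of the (trivialized) spinor line over the circle. -/
def IsCircleSection (s : SpinStructure) (χ : ℝ → ℂ) : Prop :=
  ContDiff ℝ ∞ χ ∧ ∀ θ, χ (θ + 2 * Real.pi) = s.hol * χ θ

/-- Smooth sections of the (trivialized) spinor line over the cylinder, extended to all `t`. -/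
def IsCylinderSection (s : SpinStructure) (φ : ℝ × ℝ → ℂ) : Prop :=
  ContDiff ℝ ∞ φ ∧ ∀ t θ, φ (t, θ + 2 * Real.pi) = s.hol * φ (t, θ)

end SpinStructure

/-- The interval `(0, 2π]`, a fundamental domain for the circle. -/
def circleDomain : Set ℝ := Ioc 0 (2 * Real.pi)

theorem memLp_circle {χ : ℝ → ℂ} (hχ : Continuous χ) :
    MemLp χ 2 (volume.restrict circleDomain) := by
  obtain ⟨C, hC⟩ := (isCompact_Icc (a := (0 : ℝ)) (b := 2 * Real.pi)).exists_bound_of_continuousOn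
    hχ.continuousOn
  have : IsFiniteMeasure (volume.restrict circleDomain) :=
    ⟨by rw [Measure.restrict_apply_univ]; exact measure_Ioc_lt_top⟩
  refine MemLp.of_bound hχ.aestronglyMeasurable C ?_
  filter_upwards [ae_restrict_mem (measurableSet_Ioc (a := (0 : ℝ)) (b := 2 * Real.pi))] with x hx
  exact hC x (Ioc_subset_Icc_self hx)

namespace WarpedCylinder

variable (M : WarpedCylinder)

/-- The coordinate rectangle `[0,T] × (0,2π]`. -/
def carrier : Set (ℝ × ℝ) := Icc 0 M.T ×ˢ circleDomain

/-- The Riemannian volume measure `f(t) dt dθ`. -/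
def vol : Measure (ℝ × ℝ) :=
  (volume.restrict M.carrier).withDensity fun p => ENNReal.ofReal (M.f p.1)

/-- Square-integrable sections of a trivialized spinor line over `M`; a section is
represented by its restriction to the fundamental domain. -/
abbrev L2 : Type := Lp ℂ 2 M.vol

/-- The value of `t` at a boundary component. -/
def pos : Endpoint → ℝ
  | .left => 0
  | .right => M.T

/-- The Riemannian measure `f(t₀) dθ` of a boundary component. -/
def bdryMeasure (e : Endpoint) : Measure ℝ :=
  ENNReal.ofReal (M.f (M.pos e)) • volume.restrict circleDomain

/-- Square-integrable sections of a trivialized spinor line over a boundary component. -/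
abbrev L2Bdry (e : Endpoint) : Type := Lp ℂ 2 (M.bdryMeasure e)

theorem pos_mem (e : Endpoint) : M.pos e ∈ Icc 0 M.T := by
  cases e
  · exact ⟨le_rfl, M.T_pos.le⟩
  · exact ⟨M.T_pos.le, le_rfl⟩

theorem f_at_pos (e : Endpoint) : 0 < M.f (M.pos e) := M.f_pos _ (M.pos_mem e)

theorem measurableSet_carrier : MeasurableSet M.carrier :=
  measurableSet_Icc.prod measurableSet_Ioc

/-- A coefficient depending on `t` only is measurable if it is continuous on `[0,T]`. -/
theorem coeff_aestronglyMeasurable {a : ℝ → ℝ} (ha : ContinuousOn a (Icc 0 M.T)) :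
    AEStronglyMeasurable (fun p : ℝ × ℝ => (a p.1 : ℂ)) (volume.restrict M.carrier) := by
  refine ContinuousOn.aestronglyMeasurable ?_ M.measurableSet_carrier
  exact continuous_ofReal.comp_continuousOn (ha.comp continuousOn_fst fun p hp => hp.1)

theorem vol_ac : M.vol ≪ volume.restrict M.carrier := withDensity_absolutelyContinuous _ _

theorem ae_vol_mem : ∀ᵐ p ∂M.vol, p ∈ M.carrier :=
  M.vol_ac.ae_le (ae_restrict_mem M.measurableSet_carrier)

theorem exists_lebesgue_le_vol :
    ∃ C : ENNReal, C ≠ ⊤ ∧ volume.restrict M.carrier ≤ C • M.vol := by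
  obtain ⟨t₀, ht₀, hmin⟩ := isCompact_Icc.exists_isMinOn (nonempty_Icc.2 M.T_pos.le)
    M.f_smooth.continuousOn
  have h0 : 0 < M.f t₀ := M.f_pos t₀ ht₀
  refine ⟨(ENNReal.ofReal (M.f t₀))⁻¹, by simp [h0], ?_⟩
  have hne : ENNReal.ofReal (M.f t₀) ≠ 0 := by simp [h0]
  have key : ENNReal.ofReal (M.f t₀) • volume.restrict M.carrier ≤ M.vol := by
    rw [← withDensity_const]
    refine withDensity_mono ?_
    filter_upwards [ae_restrict_mem M.measurableSet_carrier] with p hp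
    exact ENNReal.ofReal_le_ofReal (hmin hp.1)
  calc volume.restrict M.carrier
      = (ENNReal.ofReal (M.f t₀))⁻¹ • ENNReal.ofReal (M.f t₀) • volume.restrict M.carrier := by
        rw [smul_smul, ENNReal.inv_mul_cancel hne ENNReal.ofReal_ne_top, one_smul]
    _ ≤ _ := by
        intro s
        simp only [Measure.smul_apply, smul_eq_mul] at *
        gcongr
        simpa using key s

theorem exists_lebesgue_le_bdry (e : Endpoint) :
    ∃ C : ENNReal, C ≠ ⊤ ∧ volume.restrict circleDomain ≤ C • M.bdryMeasure e := by
  have h0 := M.f_at_pos e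
  have hne : ENNReal.ofReal (M.f (M.pos e)) ≠ 0 := by simp [h0]
  refine ⟨(ENNReal.ofReal (M.f (M.pos e)))⁻¹, by simp [h0], ?_⟩
  rw [bdryMeasure, smul_smul, ENNReal.inv_mul_cancel hne ENNReal.ofReal_ne_top, one_smul]

theorem memLp_carrier {φ : ℝ × ℝ → ℂ} (hφ : Continuous φ) :
    MemLp φ 2 (volume.restrict M.carrier) := by
  have hK : IsCompact (Icc 0 M.T ×ˢ Icc 0 (2 * Real.pi)) := isCompact_Icc.prod isCompact_Icc
  have hsub : M.carrier ⊆ Icc 0 M.T ×ˢ Icc 0 (2 * Real.pi) :=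
    prod_mono_right Ioc_subset_Icc_self
  obtain ⟨C, hC⟩ := hK.exists_bound_of_continuousOn hφ.continuousOn
  have : IsFiniteMeasure (volume.restrict M.carrier) :=
    ⟨by rw [Measure.restrict_apply_univ]; exact (measure_mono hsub).trans_lt hK.measure_lt_top⟩
  refine MemLp.of_bound hφ.aestronglyMeasurable C ?_
  filter_upwards [ae_restrict_mem M.measurableSet_carrier] with x hx
  exact hC x (hsub hx)

/-! ### Multiplication by a coefficient `a(t)` -/

theorem exists_coeff_bound {a : ℝ → ℝ} (ha : ContinuousOn a (Icc 0 M.T)) :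
    ∃ C, ∀ t ∈ Icc 0 M.T, ‖a t‖ ≤ C :=
  isCompact_Icc.exists_bound_of_continuousOn ha

theorem memLp_coeff_mul {a : ℝ → ℝ} (ha : ContinuousOn a (Icc 0 M.T)) (u : M.L2) :
    MemLp (fun p => (a p.1 : ℂ) * u p) 2 M.vol := by
  obtain ⟨C, hC⟩ := M.exists_coeff_bound ha
  refine (Lp.memLp u).of_le_mul (c := C)
    (((M.coeff_aestronglyMeasurable ha).mono_ac M.vol_ac).mul (Lp.aestronglyMeasurable u)) ?_
  filter_upwards [M.ae_vol_mem] with p hp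
  rw [norm_mul, norm_real]
  gcongr
  exact hC _ hp.1

/-- Multiplication by `a(t)`, for `a` continuous on `[0,T]`, as a bounded operator on `L²(M)`. -/
def mulCoeff (a : ℝ → ℝ) (ha : ContinuousOn a (Icc 0 M.T)) : M.L2 →L[ℂ] M.L2 :=
  LinearMap.mkContinuousOfExistsBound
    { toFun := fun u => (M.memLp_coeff_mul ha u).toLp
      map_add' := fun u v => by
        rw [← MemLp.toLp_add]
        refine MemLp.toLp_congr _ _ ?_
        filter_upwards [Lp.coeFn_add u v] with p hp
        rw [Pi.add_apply, ← mul_add, hp, Pi.add_apply]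
      map_smul' := fun c u => by
        rw [RingHom.id_apply, ← MemLp.toLp_const_smul]
        refine MemLp.toLp_congr _ _ ?_
        filter_upwards [Lp.coeFn_smul c u] with p hp
        simp only [hp, Pi.smul_apply, smul_eq_mul]
        ring }
    (by
      obtain ⟨C, hC⟩ := M.exists_coeff_bound ha
      refine ⟨C, fun u => Lp.norm_le_mul_norm_of_ae_le_mul ?_⟩
      filter_upwards [M.ae_vol_mem, MemLp.coeFn_toLp (M.memLp_coeff_mul ha u)] with p hp h
      change ‖((M.memLp_coeff_mul ha u).toLp : M.L2) p‖ ≤ _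
      rw [h, norm_mul, norm_real]
      gcongr
      exact hC _ hp.1)

/-- The derivative `f'` on `[0,T]`. -/
def fDeriv : ℝ → ℝ := derivWithin M.f (Icc 0 M.T)

theorem continuousOn_inv_f : ContinuousOn (fun t => 1 / M.f t) (Icc 0 M.T) :=
  continuousOn_const.div M.f_smooth.continuousOn fun t ht => (M.f_pos t ht).ne'

theorem continuousOn_fDeriv_div :
    ContinuousOn (fun t => M.fDeriv t / (2 * M.f t)) (Icc 0 M.T) :=
  (M.f_smooth.continuousOn_derivWithin (uniqueDiffOn_Icc M.T_pos) (by simp)).div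
    (continuousOn_const.mul M.f_smooth.continuousOn)
    fun t ht => mul_ne_zero two_ne_zero (M.f_pos t ht).ne'

/-! ### Sobolev spaces -/

/-- The Sobolev space `H¹` of a spinor line over a boundary component. An element is a pair
`(φ, ∂_θ φ)` of `L²` sections, the second being the weak derivative of the first (which
determines it). -/
def H1Bdry (s : SpinStructure) (e : Endpoint) : Submodule ℂ (M.L2Bdry e × M.L2Bdry e) where
  carrier := {x | ∀ χ : ℝ → ℂ, s.IsCircleSection χ →
    (∫ θ in circleDomain, x.1 θ * deriv χ θ) + ∫ θ in circleDomain, x.2 θ * χ θ = 0}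
  add_mem' := by
    intro x y hx hy χ hχ
    obtain ⟨C, hC, hle⟩ := M.exists_lebesgue_le_bdry e
    have h0 := memLp_circle hχ.1.continuous
    have h1 := memLp_circle (hχ.1.continuous_deriv (by simp))
    have ex := hx χ hχ
    have ey := hy χ hχ
    rw [Prod.fst_add, Prod.snd_add, LpAux.integral_add_mul hC hle _ _ h0,
      LpAux.integral_add_mul hC hle _ _ h1]
    linear_combination ex + ey
  zero_mem' := by
    intro χ _
    obtain ⟨C, hC, hle⟩ := M.exists_lebesgue_le_bdry e
    rw [Prod.fst_zero, Prod.snd_zero, LpAux.integral_zero_mul hle, LpAux.integral_zero_mul hle,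
      add_zero]
  smul_mem' := by
    intro c x hx χ hχ
    obtain ⟨C, hC, hle⟩ := M.exists_lebesgue_le_bdry e
    have ex := hx χ hχ
    rw [Prod.smul_fst, Prod.smul_snd, LpAux.integral_smul_mul hle, LpAux.integral_smul_mul hle]
    linear_combination c * ex

/-- The Sobolev space `H¹` of a spinor line over `M`. An element is a tuple
`(ψ, ∂_t ψ, ∂_θ ψ, ψ|_{t=0}, ψ|_{t=T})` of `L²` sections: the weak derivatives and the boundary
traces of `ψ`, which are characterized (and determined) by Green's formula against all smooth
sections up to the boundary. -/
def H1 (s : SpinStructure) :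
    Submodule ℂ (M.L2 × M.L2 × M.L2 × M.L2Bdry .left × M.L2Bdry .right) where
  carrier := {x | ∀ φ : ℝ × ℝ → ℂ, s.IsCylinderSection φ →
    ((∫ p in M.carrier, x.1 p * fderiv ℝ φ p (1, 0)) + (∫ p in M.carrier, x.2.1 p * φ p)
      = (∫ θ in circleDomain, x.2.2.2.2 θ * φ (M.T, θ))
        - ∫ θ in circleDomain, x.2.2.2.1 θ * φ (0, θ)) ∧
    (∫ p in M.carrier, x.1 p * fderiv ℝ φ p (0, 1)) + (∫ p in M.carrier, x.2.2.1 p * φ p) = 0}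
  add_mem' := by
    intro x y hx hy φ hφ
    obtain ⟨C, hC, hle⟩ := M.exists_lebesgue_le_vol
    obtain ⟨C₀, hC₀, hle₀⟩ := M.exists_lebesgue_le_bdry .left
    obtain ⟨C₁, hC₁, hle₁⟩ := M.exists_lebesgue_le_bdry .right
    have hc := hφ.1.continuous
    have hd : Continuous (fderiv ℝ φ) := hφ.1.continuous_fderiv (by simp)
    have h0 := M.memLp_carrier hc
    have h1 := M.memLp_carrier (hd.clm_apply (continuous_const (y := ((1 : ℝ), (0 : ℝ)))))
    have h2 := M.memLp_carrier (hd.clm_apply (continuous_const (y := ((0 : ℝ), (1 : ℝ)))))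
    have b0 := memLp_circle (hc.comp (by fun_prop : Continuous fun θ : ℝ => ((0 : ℝ), θ)))
    have b1 := memLp_circle (hc.comp (by fun_prop : Continuous fun θ : ℝ => (M.T, θ)))
    obtain ⟨ex, ex'⟩ := hx φ hφ
    obtain ⟨ey, ey'⟩ := hy φ hφ
    have i0 := LpAux.integral_add_mul hC hle x.1 y.1 h1
    have i0' := LpAux.integral_add_mul hC hle x.1 y.1 h2
    have i1 := LpAux.integral_add_mul hC hle x.2.1 y.2.1 h0
    have i2 := LpAux.integral_add_mul hC hle x.2.2.1 y.2.2.1 h0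
    have i3 := LpAux.integral_add_mul hC₀ hle₀ x.2.2.2.1 y.2.2.2.1 b0
    have i4 := LpAux.integral_add_mul hC₁ hle₁ x.2.2.2.2 y.2.2.2.2 b1
    simp only [Function.comp_apply] at i3 i4
    simp only [Prod.fst_add, Prod.snd_add]
    rw [i0, i0', i1, i2, i3, i4]
    exact ⟨by linear_combination ex + ey, by linear_combination ex' + ey'⟩
  zero_mem' := by
    intro φ _
    obtain ⟨C, hC, hle⟩ := M.exists_lebesgue_le_vol
    obtain ⟨C₀, hC₀, hle₀⟩ := M.exists_lebesgue_le_bdry .left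
    obtain ⟨C₁, hC₁, hle₁⟩ := M.exists_lebesgue_le_bdry .right
    simp only [Prod.fst_zero, Prod.snd_zero]
    simp only [LpAux.integral_zero_mul hle, LpAux.integral_zero_mul hle₀,
      LpAux.integral_zero_mul hle₁]
    simp
  smul_mem' := by
    intro c x hx φ hφ
    obtain ⟨C, hC, hle⟩ := M.exists_lebesgue_le_vol
    obtain ⟨C₀, hC₀, hle₀⟩ := M.exists_lebesgue_le_bdry .left
    obtain ⟨C₁, hC₁, hle₁⟩ := M.exists_lebesgue_le_bdry .right
    obtain ⟨ex, ex'⟩ := hx φ hφ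
    simp only [Prod.smul_fst, Prod.smul_snd]
    simp only [LpAux.integral_smul_mul hle, LpAux.integral_smul_mul hle₀,
      LpAux.integral_smul_mul hle₁]
    exact ⟨by linear_combination c * ex, by linear_combination c * ex'⟩

section Components

variable (s : SpinStructure)

/-- The inclusion `H¹(M) → L²(M)`. -/
def incl : M.H1 s →L[ℂ] M.L2 :=
  (ContinuousLinearMap.fst ℂ _ _).comp (M.H1 s).subtypeL

/-- `∂_t : H¹(M) → L²(M)`. -/
def dt : M.H1 s →L[ℂ] M.L2 :=
  (ContinuousLinearMap.fst ℂ _ _).comp <|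
    (ContinuousLinearMap.snd ℂ _ _).comp (M.H1 s).subtypeL

/-- `∂_θ : H¹(M) → L²(M)`. -/
def dθ : M.H1 s →L[ℂ] M.L2 :=
  (ContinuousLinearMap.fst ℂ _ _).comp <| (ContinuousLinearMap.snd ℂ _ _).comp <|
    (ContinuousLinearMap.snd ℂ _ _).comp (M.H1 s).subtypeL

/-- The trace of an `H¹` section on a boundary component. -/
def trace : (e : Endpoint) → M.H1 s →L[ℂ] M.L2Bdry e
  | .left =>
    (ContinuousLinearMap.fst ℂ _ _).comp <| (ContinuousLinearMap.snd ℂ _ _).comp <|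
      (ContinuousLinearMap.snd ℂ _ _).comp <| (ContinuousLinearMap.snd ℂ _ _).comp
        (M.H1 s).subtypeL
  | .right =>
    (ContinuousLinearMap.snd ℂ _ _).comp <| (ContinuousLinearMap.snd ℂ _ _).comp <|
      (ContinuousLinearMap.snd ℂ _ _).comp <| (ContinuousLinearMap.snd ℂ _ _).comp
        (M.H1 s).subtypeL

variable (e : Endpoint)

/-- The inclusion `H¹(Y) → L²(Y)`. -/
def bdryIncl : M.H1Bdry s e →L[ℂ] M.L2Bdry e :=
  (ContinuousLinearMap.fst ℂ _ _).comp (M.H1Bdry s e).subtypeL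

/-- `∂_θ : H¹(Y) → L²(Y)`. -/
def bdryDθ : M.H1Bdry s e →L[ℂ] M.L2Bdry e :=
  (ContinuousLinearMap.snd ℂ _ _).comp (M.H1Bdry s e).subtypeL

end Components

end WarpedCylinder

/-! ## The Dirac operator -/

/-- Clifford multiplication by `e₁ = ∂_t`. -/
def gamma1 : Matrix (Fin 2) (Fin 2) ℂ := !![0, 1; 1, 0]

/-- Clifford multiplication by `e₂ = f⁻¹ ∂_θ`. -/
def gamma2 : Matrix (Fin 2) (Fin 2) ℂ := !![0, -I; I, 0]

/-- The action of a `2 × 2` matrix on spinors with components in `V`. -/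
def matAct {V : Type*} [NormedAddCommGroup V] [NormedSpace ℂ V] (g : Matrix (Fin 2) (Fin 2) ℂ) :
    (Fin 2 → V) →L[ℂ] (Fin 2 → V) :=
  ContinuousLinearMap.pi fun i => ∑ j, g i j • ContinuousLinearMap.proj j

/-- Apply an operator to both components of a spinor. -/
def compwise {V W : Type*} [NormedAddCommGroup V] [NormedSpace ℂ V] [NormedAddCommGroup W]
    [NormedSpace ℂ W] (L : V →L[ℂ] W) : (Fin 2 → V) →L[ℂ] (Fin 2 → W) :=
  ContinuousLinearMap.pi fun i => L.comp (ContinuousLinearMap.proj i)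

/-- The inclusion of `S⁺` in `S⁻ ⊕ S⁺`. The chirality matrix `i γ₁ γ₂ = diag(-1, 1)` makes the
lower component the positive one. -/
def inclPlus {V : Type*} [NormedAddCommGroup V] [NormedSpace ℂ V] : V →L[ℂ] (Fin 2 → V) :=
  ContinuousLinearMap.single ℂ (fun _ : Fin 2 => V) 1

namespace WarpedCylinder

variable (M : WarpedCylinder) (s : SpinStructure) (A : ℝ)

/-- The covariant derivative along `e₁ = ∂_t`. -/
def nabla1 : (Fin 2 → M.H1 s) →L[ℂ] (Fin 2 → M.L2) := compwise (M.dt s)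

/-- The covariant derivative along `e₂`,
`f⁻¹ (∂_θ + iA) - (f' / 2f) γ₁ γ₂`, of the spinor bundle coupled to the constant `U(1)`
connection `d + i A dθ`. -/
def nabla2 : (Fin 2 → M.H1 s) →L[ℂ] (Fin 2 → M.L2) :=
  compwise ((M.mulCoeff (fun t => 1 / M.f t) M.continuousOn_inv_f).comp
      (M.dθ s + (I * (A : ℂ)) • M.incl s))
    - (matAct (gamma1 * gamma2)).comp
        (compwise ((M.mulCoeff (fun t => M.fDeriv t / (2 * M.f t))
          M.continuousOn_fDeriv_div).comp (M.incl s)))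

/-- The Dirac operator `D = i γ_a ∇_{e_a}`. -/
def dirac : (Fin 2 → M.H1 s) →L[ℂ] (Fin 2 → M.L2) :=
  I • ((matAct gamma1).comp (M.nabla1 s) + (matAct gamma2).comp (M.nabla2 s A))

/-- The chiral Dirac operator `D⁺ : H¹(M; S⁺) → L²(M; S⁻)`. -/
def diracPlus : M.H1 s →L[ℂ] M.L2 :=
  (ContinuousLinearMap.proj (0 : Fin 2)).comp ((M.dirac s A).comp inclPlus)

end WarpedCylinder

/-! ## Boundary operators -/

/-- The coefficient `±1` in `N = ± e₁`. -/
def normalCoeff : NormalConvention → Endpoint → ℂ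
  | .inward, .left => 1
  | .inward, .right => -1
  | .outward, .left => -1
  | .outward, .right => 1

/-- Clifford multiplication by the unit tangent `U = e₂` on the boundary,
`c(U) = -i γ(N) γ(U)`. -/
def boundaryClifford (ν : NormalConvention) (e : Endpoint) : Matrix (Fin 2) (Fin 2) ℂ :=
  (-I) • ((normalCoeff ν e • gamma1) * gamma2)

namespace WarpedCylinder

variable (M : WarpedCylinder) (s : SpinStructure) (A : ℝ)

/-- The Hermitian tangential operator `f(t₀)⁻¹ (-i ∂_θ + A)`. -/
def tangential (e : Endpoint) : M.H1Bdry s e →L[ℂ] M.L2Bdry e :=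
  (1 / (M.f (M.pos e) : ℂ)) • ((-I) • M.bdryDθ s e + (A : ℂ) • M.bdryIncl s e)

/-- The boundary Dirac operator `B = c(U) f(t₀)⁻¹ (-i ∂_θ + A)` on spinors. -/
def boundaryDirac (ν : NormalConvention) (e : Endpoint) :
    (Fin 2 → M.H1Bdry s e) →L[ℂ] (Fin 2 → M.L2Bdry e) :=
  (matAct (boundaryClifford ν e)).comp (compwise (M.tangential s A e))

/-- The chiral endpoint operator `B⁺`, the restriction of the boundary Dirac operator to `S⁺`, as
a map from its domain `H¹(Y; S⁺)` to `L²(Y; S⁺)`. -/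
def boundaryPlus (ν : NormalConvention) (e : Endpoint) : M.H1Bdry s e →L[ℂ] M.L2Bdry e :=
  (ContinuousLinearMap.proj (1 : Fin 2)).comp ((M.boundaryDirac s A ν e).comp inclPlus)

end WarpedCylinder

/-! ## Unbounded operators, `η`-invariants

An unbounded operator in a Hilbert space `H` is given by its domain `V` with the (injective)
inclusion `ι : V → H` and the operator `B : V → H`. -/

section Unbounded

variable {V H : Type*} [TopologicalSpace V] [AddCommGroup V] [Module ℂ V]
  [NormedAddCommGroup H] [InnerProductSpace ℂ H]

/-- The operator is a bijection of its domain onto `H` with bounded inverse. -/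
def IsInvertibleOp (ι B : V →L[ℂ] H) : Prop :=
  Function.Bijective B ∧ ∃ C : ℝ, ∀ x, ‖ι x‖ ≤ C * ‖B x‖

/-- The eigenspace for `μ`, as a subspace of `H`. -/
def eigenspaceOp (ι B : V →L[ℂ] H) (μ : ℝ) : Submodule ℂ H :=
  (LinearMap.ker ((B - (μ : ℂ) • ι : V →L[ℂ] H) : V →ₗ[ℂ] H)).map (ι : V →ₗ[ℂ] H)

/-- The closed span of the eigenspaces with positive eigenvalue. -/
def positiveSpace (ι B : V →L[ℂ] H) : Submodule ℂ H :=
  (⨆ μ : {μ : ℝ // 0 < μ}, eigenspaceOp ι B μ).topologicalClosure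

/-- The spectral projection `P_{>0}(B)`. -/
def positiveProj [CompleteSpace H] (ι B : V →L[ℂ] H) : H →L[ℂ] H :=
  haveI : CompleteSpace (positiveSpace ι B) := Submodule.topologicalClosure.completeSpace _
  (positiveSpace ι B).starProjection

/-- `η(B, 0) = x`: all eigenspaces for nonzero eigenvalues are finite-dimensional, and the series
`∑ sign(μ) |μ|^{-s}` over the nonzero eigenvalues, counted with multiplicity, converges for `Re s`
large to a function with a meromorphic continuation to `ℂ` that is regular at `0` with value
`x`. -/
def HasEtaInvariant (ι B : V →L[ℂ] H) (x : ℂ) : Prop :=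
  (∀ μ : ℝ, μ ≠ 0 → FiniteDimensional ℂ (eigenspaceOp ι B μ)) ∧
  ∃ (F : ℂ → ℂ) (σ : ℝ),
    (∀ z : ℂ, σ < z.re →
      HasSum (fun μ : {μ : ℝ // μ ≠ 0} =>
        (Module.finrank ℂ (eigenspaceOp ι B μ) : ℂ) * ((SignType.sign (μ : ℝ) : ℝ) : ℂ)
          * ((|(μ : ℝ)| : ℝ) : ℂ) ^ (-z)) (F z)) ∧
    Meromorphic F ∧ AnalyticAt ℂ F 0 ∧ F 0 = x

/-- `ξ(B) = x`, where `ξ(B) = (η(B, 0) + dim ker B) / 2`. -/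
def HasReducedEta (ι B : V →L[ℂ] H) (x : ℂ) : Prop :=
  FiniteDimensional ℂ (eigenspaceOp ι B 0) ∧
  ∃ η : ℂ, HasEtaInvariant ι B η ∧ x = (η + Module.finrank ℂ (eigenspaceOp ι B 0)) / 2

/-- `dim ker D` and `dim ker D*` are finite with `dim ker D - dim ker D* = n`. The kernel of the adjoint of the
unbounded operator `D` is the orthogonal complement of its range. -/
def HasAdjointIndex (D : V →L[ℂ] H) (n : ℤ) : Prop :=
  FiniteDimensional ℂ (LinearMap.ker (D : V →ₗ[ℂ] H)) ∧
  FiniteDimensional ℂ (LinearMap.range (D : V →ₗ[ℂ] H))ᗮ ∧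
  (Module.finrank ℂ (LinearMap.ker (D : V →ₗ[ℂ] H)) : ℤ)
    - Module.finrank ℂ (LinearMap.range (D : V →ₗ[ℂ] H))ᗮ = n

end Unbounded

/-- The operator `D` is Fredholm with index `dim ker D - dim coker D = n`. -/
def IsFredholmOfIndex {V W : Type*} [NormedAddCommGroup V] [NormedSpace ℂ V]
    [NormedAddCommGroup W] [NormedSpace ℂ W] (D : V →L[ℂ] W) (n : ℤ) : Prop :=
  D.IsFredholm ∧
  (Module.finrank ℂ (LinearMap.ker (D : V →ₗ[ℂ] W)) : ℤ)
    - Module.finrank ℂ (W ⧸ LinearMap.range (D : V →ₗ[ℂ] W)) = n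

/-! ## The Atiyah–Patodi–Singer problem -/

namespace WarpedCylinder

variable (M : WarpedCylinder) (s : SpinStructure) (A : ℝ)

/-- The condition `P_{>0}(B⁺)(ψ|_Y) = 0` at one boundary component. -/
def apsCondition (ν : NormalConvention) (e : Endpoint) : Submodule ℂ (M.H1 s) :=
  LinearMap.ker (((positiveProj (M.bdryIncl s e) (M.boundaryPlus s A ν e)).comp
    (M.trace s e) : M.H1 s →L[ℂ] M.L2Bdry e) : M.H1 s →ₗ[ℂ] M.L2Bdry e)

/-- The APS domain in `H¹(M; S⁺)`. -/
def apsDomain (ν : NormalConvention) : Submodule ℂ (M.H1 s) :=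
  M.apsCondition s A ν .left ⊓ M.apsCondition s A ν .right

/-- The chiral Dirac operator on its APS domain. -/
def diracAPS (ν : NormalConvention) : M.apsDomain s A ν →L[ℂ] M.L2 :=
  (M.diracPlus s A).comp (M.apsDomain s A ν).subtypeL

end WarpedCylinder

end

noncomputable section

/-! ## Operators that are block diagonal with respect to an orthogonal family -/

section Modes

variable {ι V H H' : Type*} [NormedAddCommGroup V] [NormedSpace ℂ V]
  [NormedAddCommGroup H] [InnerProductSpace ℂ H]
  [NormedAddCommGroup H'] [InnerProductSpace ℂ H']

/-! Everything separates in Fourier modes. On `u(t) exp(ikθ)`, with `l = k + A`, the operator `D⁺`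
becomes `i(u' + (f'/2f + l/f) u)`, a scalar first-order equation. The endpoint operators multiply
the mode by `c l`, where `c` has opposite signs at the two ends because the two normals point in
opposite `t`-directions. Since `l ≠ 0`, exactly one end of each mode has a positive eigenvalue, so
the APS condition says that `u` vanishes at that end and leaves the other end free.

Invertibility of `B⁺` follows from a uniform gap `|l| ≥ δ`. Its eigenvalues are simple and form a
scaled, shifted copy of `ℤ`, so the `η`-series is a multiple of the entire odd Hurwitz zeta
function. At `z = 0` the scale drops out and only the sign of `c` remains; hence the two ends cancel
(`etaFunction_add_etaFunction`).

For the index with either normal, a first-order linear equation with one zero initial value is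
uniquely solvable. Uniqueness, in weak form through the adjoint equation, gives a trivial kernel
(`eq_zero_of_diracPlus_eq_zero`). Existence in each mode shows that the range has trivial orthogonal
complement (`apsMode_total`). This needs no estimate uniform in the mode.

Fredholmness for the outward normal does need one. With `p = u' + (f'/2f) u` the cross term in `f²|p
+ l u/f|²` is an exact derivative, and integration leaves the boundary term `l (f(T)|u(T)|² -
f(0)|u(0)|²)` (`energy_identity`). The outward condition makes it nonnegative; the inward condition
gives it the opposite sign. The resulting `H¹` bounds have constants independent of the mode, sum by
Pythagoras, and give closed range (`exists_preimage_of_total`). Together with the trivial kernel and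
dense range, this makes the outward operator bijective. -/

theorem norm_sq_sum_of_orthogonal (S : Finset ι) (y : ι → H)
    (hy : ∀ n m, n ≠ m → inner ℂ (y n) (y m) = 0) :
    ‖∑ n ∈ S, y n‖ ^ 2 = ∑ n ∈ S, ‖y n‖ ^ 2 := by
  classical
  induction S using Finset.induction_on with
  | empty => simp
  | insert a S ha ih =>
    rw [Finset.sum_insert ha, Finset.sum_insert ha, ← ih, sq, sq, sq]
    refine norm_add_sq_eq_norm_sq_add_norm_sq_of_inner_eq_zero (𝕜 := ℂ) _ _ ?_
    rw [inner_sum]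
    exact Finset.sum_eq_zero fun m hm => hy a m fun h => ha (h ▸ hm)

/-- Pythagoras on both sides turns blockwise estimates with a common constant into an estimate on
finite sums. Only the images need be orthogonal, so `V` may carry any norm, such as the sup norm of
a product. -/
theorem norm_map_sum_le_of_orthogonal (L : V →L[ℂ] H') (D : V →L[ℂ] H) {C : ℝ} (hC : 0 ≤ C)
    (S : Finset ι) (x : ι → V)
    (hL : ∀ n m, n ≠ m → inner ℂ (L (x n)) (L (x m)) = 0)
    (hD : ∀ n m, n ≠ m → inner ℂ (D (x n)) (D (x m)) = 0)
    (hLD : ∀ n, ‖L (x n)‖ ≤ C * ‖D (x n)‖) :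
    ‖L (∑ n ∈ S, x n)‖ ≤ C * ‖D (∑ n ∈ S, x n)‖ := by
  refine le_of_sq_le_sq ?_ (by positivity)
  rw [map_sum, map_sum, mul_pow, norm_sq_sum_of_orthogonal S _ hL,
    norm_sq_sum_of_orthogonal S _ hD, Finset.mul_sum]
  refine Finset.sum_le_sum fun n _ => ?_
  rw [← mul_pow]
  exact pow_le_pow_left₀ (norm_nonneg _) (hLD n) 2

/-- An operator on a Banach space that is bounded below on the finite sums of a family of
subspaces, and maps these onto a total set, has a bounded right inverse. -/
theorem exists_preimage_of_total [CompleteSpace V] [CompleteSpace H] (D : V →L[ℂ] H)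
    (X : ι → Submodule ℂ V) {C : ℝ} (hC : 0 ≤ C)
    (bound : ∀ (S : Finset ι) (x : ι → V), (∀ n, x n ∈ X n) →
      ‖∑ n ∈ S, x n‖ ≤ C * ‖D (∑ n ∈ S, x n)‖)
    (total : ∀ y : H, (∀ n, ∀ x ∈ X n, inner ℂ (D x) y = 0) → y = 0) (y : H) :
    ∃ x, D x = y ∧ ‖x‖ ≤ C * ‖y‖ := by
  set F : Submodule ℂ V := ⨆ n, X n with hF
  have hbF : ∀ x ∈ F, ‖x‖ ≤ C * ‖D x‖ := by
    intro x hx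
    obtain ⟨g, hg, rfl⟩ := (Submodule.mem_iSup_iff_exists_finsupp _ _).1 hx
    exact bound g.support g hg
  -- The lower bound is a closed condition, so it passes to the closure, which is complete; there it
  -- forces closed range.
  have hbG : ∀ x ∈ F.topologicalClosure, ‖x‖ ≤ C * ‖D x‖ := by
    intro x hx
    have hcl : IsClosed {x : V | ‖x‖ ≤ C * ‖D x‖} :=
      isClosed_le continuous_norm (continuous_const.mul D.continuous.norm)
    exact closure_minimal (fun z hz => hbF z hz) hcl hx
  let G := F.topologicalClosure
  have : CompleteSpace G := F.isClosed_topologicalClosure.completeSpace_coe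
  let DG : G →L[ℂ] H := D.comp G.subtypeL
  have hanti : AntilipschitzWith C.toNNReal DG := by
    refine AddMonoidHomClass.antilipschitz_of_bound DG fun x => ?_
    rw [Real.coe_toNNReal _ hC]
    exact hbG x x.2
  have hclosed : IsClosed (LinearMap.range (DG : G →ₗ[ℂ] H) : Set H) := by
    rw [LinearMap.coe_range]
    exact hanti.isClosed_range DG.uniformContinuous
  -- A closed subspace of a Hilbert space with zero orthogonal complement is everything.
  have htop : LinearMap.range (DG : G →ₗ[ℂ] H) = ⊤ := by
    have : CompleteSpace (LinearMap.range (DG : G →ₗ[ℂ] H)) := hclosed.completeSpace_coe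
    rw [← Submodule.orthogonal_eq_bot_iff, Submodule.eq_bot_iff]
    intro z hz
    refine total z fun n x hx => ?_
    have hxG : x ∈ G := F.le_topologicalClosure (Submodule.mem_iSup_of_mem n hx)
    exact (Submodule.mem_orthogonal _ _).1 hz _ ⟨⟨x, hxG⟩, rfl⟩
  obtain ⟨x, hx⟩ : y ∈ LinearMap.range (DG : G →ₗ[ℂ] H) := htop ▸ Submodule.mem_top
  have hx' : D x = y := hx
  exact ⟨x, hx', hx' ▸ hbG x x.2⟩

/-- The kernel of the adjoint only sees the closure of the range, so dense range suffices and closed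
range is not required. This is what allows both normals to be treated alike. -/
theorem hasAdjointIndex_zero_of_injective {V : Type*} [TopologicalSpace V] [AddCommGroup V]
    [Module ℂ V] (D : V →L[ℂ] H) (inj : ∀ x, D x = 0 → x = 0)
    (total : ∀ y : H, (∀ x, inner ℂ (D x) y = 0) → y = 0) : HasAdjointIndex D 0 := by
  have h1 : LinearMap.ker (D : V →ₗ[ℂ] H) = ⊥ :=
    (Submodule.eq_bot_iff _).2 fun x hx => inj x hx
  have h2 : (LinearMap.range (D : V →ₗ[ℂ] H))ᗮ = ⊥ :=
    (Submodule.eq_bot_iff _).2 fun y hy => total y fun x =>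
      (Submodule.mem_orthogonal _ _).1 hy _ ⟨x, rfl⟩
  unfold HasAdjointIndex
  rw [h1, h2]
  exact ⟨inferInstance, inferInstance, by simp⟩

theorem isFredholmOfIndex_zero_of_bijective {W : Type*} [NormedAddCommGroup W] [NormedSpace ℂ W]
    [CompleteSpace V] [CompleteSpace W] (D : V →L[ℂ] W) (hD : Function.Bijective D) :
    IsFredholmOfIndex D 0 := by
  have h1 : LinearMap.ker (D : V →ₗ[ℂ] W) = ⊥ := LinearMap.ker_eq_bot.2 hD.1
  have h2 : LinearMap.range (D : V →ₗ[ℂ] W) = ⊤ := LinearMap.range_eq_top.2 hD.2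
  refine ⟨?_, ?_⟩
  · have h3 : (D : V →ₗ[ℂ] W).range.CoFG := by rw [h2]; infer_instance
    exact
      { isStrictMap := (D.isOpenMap hD.2).isStrictMap D.continuous
        isClosed_range := by rw [h2]; exact isClosed_univ
        finite_ker := by rw [h1]; infer_instance
        finite_coker := h3
        closedComplemented_ker := by rw [h1]; exact Submodule.closedComplemented_bot }
  · rw [h1, h2]
    have : Subsingleton (W ⧸ (⊤ : Submodule ℂ W)) := Submodule.Quotient.subsingleton_iff.2 rfl
    rw [finrank_bot, Module.finrank_zero_of_subsingleton, sub_self]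

end Modes

/-! ## Real-variable preliminaries -/

/-- Linear inhomogeneous equations of the first order have global solutions. -/
theorem exists_hasDerivAt_linear {E : Type*} [NormedAddCommGroup E] [NormedSpace ℝ E]
    [CompleteSpace E] {c : ℝ → ℝ} (hc : Continuous c) {h : ℝ → E} (hh : Continuous h) (t₀ : ℝ)
    (v₀ : E) : ∃ v : ℝ → E, v t₀ = v₀ ∧ ∀ t, HasDerivAt v (c t • v t + h t) t := by
  -- Variation of constants: `exp(-Λ)` is the integrating factor.
  set Λ : ℝ → ℝ := fun t => ∫ x in t₀..t, c x with hΛ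
  have dΛ : ∀ t, HasDerivAt Λ (c t) t := fun t => hc.integral_hasStrictDerivAt t₀ t |>.hasDerivAt
  have cΛ : Continuous Λ := continuous_iff_continuousAt.2 fun t => (dΛ t).continuousAt
  set w : ℝ → E := fun x => Real.exp (-Λ x) • h x with hw
  have cw : Continuous w := by fun_prop
  have dw : ∀ t, HasDerivAt (fun t => v₀ + ∫ x in t₀..t, w x) (w t) t := fun t =>
    (cw.integral_hasStrictDerivAt t₀ t).hasDerivAt.const_add v₀
  refine ⟨fun t => Real.exp (Λ t) • (v₀ + ∫ x in t₀..t, w x), by simp [hΛ], fun t => ?_⟩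
  refine ((dΛ t).exp.smul (dw t)).congr_deriv ?_
  simp only [hw, smul_smul, ← Real.exp_add, add_neg_cancel, Real.exp_zero, one_smul]
  rw [add_comm, mul_comm]

/-- The gap is the distance from `x` to the nearest integer. A single `δ` for all `n` is what makes
the later constants independent of the mode. -/
theorem exists_pos_le_abs_int_add {x : ℝ} (hx : ∀ n : ℤ, (n : ℝ) + x ≠ 0) :
    ∃ δ > 0, ∀ n : ℤ, δ ≤ |(n : ℝ) + x| := by
  refine ⟨|x - round x|, abs_pos.2 fun h => hx (-round x) ?_, fun n => ?_⟩
  · push_cast; linarith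
  · have := round_le x (-n)
    rwa [Int.cast_neg, sub_neg_eq_add, add_comm x] at this

/-- A continuous function on the line is a uniform limit of polynomials on compact intervals. -/
theorem exists_contDiff_near {T : ℝ} {h : ℝ → ℝ} (hh : Continuous h) {ε : ℝ} (hε : 0 < ε) :
    ∃ q : ℝ → ℝ, ContDiff ℝ ∞ q ∧ ∀ t ∈ Icc 0 T, |q t - h t| < ε := by
  obtain ⟨p, hp⟩ := exists_polynomial_near_of_continuousOn 0 T h hh.continuousOn ε hε
  exact ⟨fun t => p.eval t, by simpa using p.contDiff_aeval (𝕜 := ℝ) ∞, hp⟩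

/-! ### Pairings of `L²` classes with test functions -/

namespace LpAux

variable {α : Type*} [MeasurableSpace α] {μ : Measure α}

theorem inner_toLp {φ : α → ℂ} (hφ : MemLp φ 2 μ) (u : Lp ℂ 2 μ) :
    inner ℂ hφ.toLp u = ∫ x, u x * (starRingEnd ℂ) (φ x) ∂μ := by
  rw [L2.inner_def]
  refine integral_congr_ae ?_
  filter_upwards [hφ.coeFn_toLp] with x hx
  rw [hx, RCLike.inner_apply]

end LpAux

namespace LpAux

variable {α : Type*} [MeasurableSpace α] {μ ν : Measure α} {C : ENNReal}

/-- Cauchy–Schwarz in `L²(ν)`, whose norm is at most `C^(1/2)` times that of `L²(μ)`. The Sobolev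
spaces are cut out by such pairings, with Lebesgue measure for `ν` and Riemannian measure for `μ`;
continuity makes them closed. -/
theorem continuous_integral_mul (hC : C ≠ ⊤) (hν : ν ≤ C • μ) {φ : α → ℂ} (hφ : MemLp φ 2 ν) :
    Continuous fun u : Lp ℂ 2 μ => ∫ x, u x * φ x ∂ν := by
  let Λ : Lp ℂ 2 μ →ₗ[ℂ] ℂ :=
    { toFun := fun u => ∫ x, u x * φ x ∂ν
      map_add' := fun u v => integral_add_mul hC hν u v hφ
      map_smul' := fun c u => integral_smul_mul hν c u φ }
  refine (Λ.mkContinuousOfExistsBound ?_).continuous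
  have hφ' : MemLp (fun x => (starRingEnd ℂ) (φ x)) 2 ν := hφ.star
  refine ⟨‖hφ'.toLp‖ * (C ^ (1 / (2 : ENNReal).toReal)).toReal, fun u => ?_⟩
  have hu := (Lp.memLp u).of_measure_le_smul hC hν
  have h1 : Λ u = inner ℂ hφ'.toLp hu.toLp := by
    rw [inner_toLp]
    refine integral_congr_ae ?_
    filter_upwards [hu.coeFn_toLp] with x hx
    rw [hx, Complex.conj_conj]
  rw [h1]
  refine (norm_inner_le_norm _ _).trans ?_
  rw [mul_assoc]
  gcongr
  rw [Lp.norm_toLp, Lp.norm_def, ← ENNReal.toReal_mul]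
  have hne : C ^ (1 / (2 : ENNReal).toReal) ≠ ⊤ := ENNReal.rpow_ne_top_of_nonneg (by simp) hC
  refine ENNReal.toReal_mono (ENNReal.mul_ne_top hne (Lp.eLpNorm_ne_top u)) ?_
  refine (eLpNorm_mono_measure _ hν).trans ?_
  rw [eLpNorm_smul_measure_of_ne_top (by simp), smul_eq_mul]
  simp

end LpAux

/-! ## Fourier analysis on the circle -/

namespace SpinStructure

variable (s : SpinStructure)

/-- The offset of the allowed Fourier modes from `ℤ`. -/
def shift : SpinStructure → ℝ
  | periodic => 0
  | antiperiodic => 1 / 2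

/-- The `n`-th allowed Fourier mode. -/
def freq (n : ℤ) : ℝ := n + s.shift

/-- The character `exp(i k θ)` for the `n`-th allowed mode `k`. -/
def char (n : ℤ) (θ : ℝ) : ℂ := cexp ((s.freq n : ℂ) * θ * I)

theorem freq_mem_modes (n : ℤ) : s.freq n ∈ s.modes := by
  cases s
  · exact ⟨n, by simp [freq, shift]⟩
  · exact ⟨n, rfl⟩

theorem contDiff_char (n : ℤ) : ContDiff ℝ ∞ (s.char n) := by
  unfold char
  have h : ContDiff ℝ ∞ fun θ : ℝ => (θ : ℂ) := ofRealCLM.contDiff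
  fun_prop

theorem continuous_char (n : ℤ) : Continuous (s.char n) := (s.contDiff_char n).continuous

theorem hasDerivAt_char (n : ℤ) (θ : ℝ) :
    HasDerivAt (s.char n) (I * s.freq n * s.char n θ) θ := by
  have h : HasDerivAt (fun θ : ℝ => (s.freq n : ℂ) * θ * I) ((s.freq n : ℂ) * 1 * I) θ :=
    ((ofRealCLM.hasDerivAt (x := θ)).const_mul _).mul_const _
  refine h.cexp.congr_deriv ?_
  unfold char
  ring

theorem norm_char (n : ℤ) (θ : ℝ) : ‖s.char n θ‖ = 1 := by
  unfold char
  rw [← ofReal_mul, norm_exp_ofReal_mul_I]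

theorem hol_mul_self : s.hol * s.hol = 1 := by cases s <;> simp [hol]

theorem conj_hol : (starRingEnd ℂ) s.hol = s.hol := by cases s <;> simp [hol]

theorem exp_shift : cexp ((s.shift : ℂ) * (2 * Real.pi) * I) = s.hol := by
  cases s
  · simp [shift, hol]
  · rw [shift, hol, ← exp_pi_mul_I]
    push_cast
    ring_nf

theorem char_add_two_pi (n : ℤ) (θ : ℝ) : s.char n (θ + 2 * Real.pi) = s.hol * s.char n θ := by
  have h : (s.freq n : ℂ) * ((θ + 2 * Real.pi : ℝ) : ℂ) * I
      = (s.shift : ℂ) * (2 * Real.pi) * I + (s.freq n : ℂ) * θ * I + n * (2 * Real.pi * I) := by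
    simp only [freq]
    push_cast
    ring
  unfold char
  rw [h, exp_add, exp_int_mul_two_pi_mul_I, mul_one, exp_add, exp_shift]

theorem isCircleSection_conj_char (n : ℤ) :
    s.IsCircleSection fun θ => (starRingEnd ℂ) (s.char n θ) :=
  ⟨conjCLE.contDiff.comp (s.contDiff_char n), fun θ => by
    beta_reduce
    rw [char_add_two_pi, map_mul, conj_hol]⟩

theorem hasDerivAt_conj_char (n : ℤ) (θ : ℝ) :
    HasDerivAt (fun θ => (starRingEnd ℂ) (s.char n θ))
      (-(I * s.freq n) * (starRingEnd ℂ) (s.char n θ)) θ := by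
  have := (conjCLE.toContinuousLinearMap.hasFDerivAt).comp_hasDerivAt θ (s.hasDerivAt_char n θ)
  refine this.congr_deriv ?_
  simp

theorem char_mul_conj_self (n : ℤ) (θ : ℝ) :
    s.char n θ * (starRingEnd ℂ) (s.char n θ) = 1 := by
  rw [mul_conj, normSq_eq_norm_sq, norm_char]
  simp

theorem integral_char_mul_conj {n m : ℤ} (h : n ≠ m) :
    ∫ θ in circleDomain, s.char n θ * (starRingEnd ℂ) (s.char m θ) = 0 := by
  have hc : ((n : ℂ) - m) * I ≠ 0 :=
    mul_ne_zero (sub_ne_zero.2 (by exact_mod_cast h)) I_ne_zero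
  -- The shift cancels in the product, so both spin structures reduce to integer frequencies.
  have e : ∀ θ : ℝ, s.char n θ * (starRingEnd ℂ) (s.char m θ)
      = cexp (((n : ℂ) - m) * I * θ) := by
    intro θ
    unfold char
    rw [← exp_conj, ← exp_add]
    simp only [map_mul, conj_ofReal, conj_I, freq]
    push_cast
    ring_nf
  simp_rw [e]
  rw [circleDomain, ← intervalIntegral.integral_of_le (by positivity),
    integral_exp_mul_complex hc]
  have h2 : ((n : ℂ) - m) * I * ((2 * Real.pi : ℝ) : ℂ) = ((n - m : ℤ) : ℂ) * (2 * Real.pi * I) := by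
    push_cast
    ring
  rw [h2, exp_int_mul_two_pi_mul_I]
  simp

/-- Integration by parts against a character. -/
theorem integral_char_mul_deriv (n : ℤ) {χ χ' : ℝ → ℂ} (dχ : ∀ θ, HasDerivAt χ (χ' θ) θ)
    (cχ' : Continuous χ') (hχ : χ (2 * Real.pi) = s.hol * χ 0) :
    (∫ θ in circleDomain, s.char n θ * χ' θ)
      + I * s.freq n * ∫ θ in circleDomain, s.char n θ * χ θ = 0 := by
  have cχ : Continuous χ := continuous_iff_continuousAt.2 fun t => (dχ t).continuousAt
  have cc := s.continuous_char n
  have i1 : IntervalIntegrable (fun θ => s.char n θ * χ' θ) volume 0 (2 * Real.pi) :=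
    (cc.mul cχ').intervalIntegrable _ _
  have i2 : IntervalIntegrable (fun θ => I * s.freq n * (s.char n θ * χ θ)) volume 0
    (2 * Real.pi) := (continuous_const.mul (cc.mul cχ)).intervalIntegrable _ _
  rw [circleDomain, ← intervalIntegral.integral_of_le (by positivity),
    ← intervalIntegral.integral_of_le (by positivity), ← intervalIntegral.integral_const_mul,
    ← intervalIntegral.integral_add i1 i2,
    intervalIntegral.integral_eq_sub_of_hasDerivAt (f := fun θ => s.char n θ * χ θ)]
  · have e1 := s.char_add_two_pi n 0
    rw [zero_add] at e1
    rw [e1, hχ]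
    -- Both factors pick up the holonomy, whose square is 1, so the boundary values at `0` and `2π`
    -- cancel.
    linear_combination (s.char n 0 * χ 0) * s.hol_mul_self
  · intro θ _
    refine ((s.hasDerivAt_char n θ).mul (dχ θ)).congr_deriv ?_
    ring
  · exact i1.add i2

/-- A square-integrable function all of whose Fourier coefficients vanish is zero. -/
theorem ae_eq_zero_of_fourier {u : ℝ → ℂ} (hu : MemLp u 2 (volume.restrict circleDomain))
    (h : ∀ n, ∫ θ in circleDomain, u θ * (starRingEnd ℂ) (s.char n θ) = 0) :
    ∀ᵐ θ ∂volume.restrict circleDomain, u θ = 0 := by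
  have hpi : (0 : ℝ) < 2 * Real.pi := by positivity
  -- The unimodular factor `exp(-i shift θ)` removes the twist, and Parseval for ordinary Fourier
  -- series applies to `u τ`.
  set τ : ℝ → ℂ := fun θ => (starRingEnd ℂ) (s.char 0 θ) with hτ
  have hτn : ∀ θ, ‖τ θ‖ = 1 := fun θ => by rw [hτ, RCLike.norm_conj, norm_char]
  have hτc : Continuous τ := (s.isCircleSection_conj_char 0).1.continuous
  have hf : MemLp (fun θ => u θ * τ θ) 2 (volume.restrict (Ioc 0 (2 * Real.pi))) := by
    refine hu.of_le (hu.aestronglyMeasurable.mul hτc.aestronglyMeasurable) ?_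
    filter_upwards with θ
    simp [hτn]
  have hsum := hasSum_sq_fourierCoeffOn hpi hf
  have hzero : ∀ n : ℤ, fourierCoeffOn hpi (fun θ => u θ * τ θ) n = 0 := by
    intro n
    rw [fourierCoeffOn_eq_integral, intervalIntegral.integral_of_le hpi.le]
    convert smul_zero _
    rw [← h n]
    refine integral_congr_ae ?_
    filter_upwards with θ
    rw [fourier_coe_apply, smul_eq_mul, mul_left_comm]
    congr 1
    simp only [hτ, char]
    rw [← exp_conj, ← exp_conj, ← exp_add]
    congr 1
    simp only [map_mul, conj_ofReal, conj_I, freq]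
    have : (Real.pi : ℂ) ≠ 0 := by exact_mod_cast Real.pi_ne_zero
    push_cast
    field_simp
    ring
  simp only [hzero, norm_zero, ne_eq, OfNat.ofNat_ne_zero, not_false_eq_true, zero_pow] at hsum
  have hint := hsum.unique hasSum_zero
  rw [smul_eq_mul, mul_eq_zero, intervalIntegral.integral_of_le hpi.le] at hint
  have hint' := hint.resolve_left (by simp [Real.pi_ne_zero])
  rw [integral_eq_zero_iff_of_nonneg (fun _ => by positivity)
    ((memLp_two_iff_integrable_sq_norm hf.aestronglyMeasurable).1 hf)] at hint'
  filter_upwards [hint'] with θ hθ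
  simpa [hτn] using hθ

end SpinStructure

namespace WarpedCylinder

variable (M : WarpedCylinder) (s : SpinStructure) (A : ℝ) (e : Endpoint)

/-! ## The boundary operators -/

theorem memLp_bdry {χ : ℝ → ℂ} (hχ : Continuous χ) : MemLp χ 2 (M.bdryMeasure e) :=
  (memLp_circle hχ).smul_measure ENNReal.ofReal_ne_top

theorem integral_bdry (g : ℝ → ℂ) :
    ∫ θ, g θ ∂M.bdryMeasure e = M.f (M.pos e) * ∫ θ in circleDomain, g θ := by
  rw [bdryMeasure, integral_smul_measure, ENNReal.toReal_ofReal (M.f_at_pos e).le, real_smul]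

/-- A character as an element of `L²` of a boundary component. -/
def bdryChar (n : ℤ) : M.L2Bdry e := (M.memLp_bdry e (s.continuous_char n)).toLp

theorem inner_bdryChar (n : ℤ) (y : M.L2Bdry e) :
    inner ℂ (M.bdryChar s e n) y
      = M.f (M.pos e) * ∫ θ in circleDomain, y θ * (starRingEnd ℂ) (s.char n θ) := by
  rw [bdryChar, LpAux.inner_toLp, integral_bdry]

theorem ae_of_ae_bdry {p : ℝ → Prop} (h : ∀ᵐ θ ∂M.bdryMeasure e, p θ) :
    ∀ᵐ θ ∂volume.restrict circleDomain, p θ := by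
  obtain ⟨C, _, hle⟩ := M.exists_lebesgue_le_bdry e
  exact (Measure.absolutelyContinuous_of_le_smul hle).ae_le h

theorem bdry_ext {y : M.L2Bdry e} (h : ∀ n, inner ℂ (M.bdryChar s e n) y = 0) : y = 0 := by
  obtain ⟨C, hC, hle⟩ := M.exists_lebesgue_le_bdry e
  have hne : (M.f (M.pos e) : ℂ) ≠ 0 := by exact_mod_cast (M.f_at_pos e).ne'
  have := s.ae_eq_zero_of_fourier ((Lp.memLp y).of_measure_le_smul hC hle) fun n => by
    simpa [inner_bdryChar, hne] using h n
  refine (Lp.eq_zero_iff_ae_eq_zero).2 ?_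
  exact (Measure.smul_absolutelyContinuous (c := ENNReal.ofReal (M.f (M.pos e)))).ae_le this

theorem coeFn_bdryChar (n : ℤ) : ∀ᵐ θ ∂volume.restrict circleDomain,
    M.bdryChar s e n θ = s.char n θ :=
  M.ae_of_ae_bdry e (M.memLp_bdry e (s.continuous_char n)).coeFn_toLp

theorem inner_bdryChar_of_ne {n m : ℤ} (h : n ≠ m) :
    inner ℂ (M.bdryChar s e n) (M.bdryChar s e m) = 0 := by
  rw [inner_bdryChar, ← mul_zero, ← s.integral_char_mul_conj h.symm]
  congr 1
  refine integral_congr_ae ?_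
  filter_upwards [M.coeFn_bdryChar s e m] with θ h
  rw [h]

theorem inner_bdryChar_self (n : ℤ) :
    inner ℂ (M.bdryChar s e n) (M.bdryChar s e n) = ((2 * Real.pi * M.f (M.pos e) : ℝ) : ℂ) := by
  have : ∫ θ in circleDomain, M.bdryChar s e n θ * (starRingEnd ℂ) (s.char n θ)
      = ∫ θ in circleDomain, (1 : ℂ) := by
    refine integral_congr_ae ?_
    filter_upwards [M.coeFn_bdryChar s e n] with θ h
    rw [h, s.char_mul_conj_self]
  rw [inner_bdryChar, this, integral_const, measureReal_restrict_apply_univ, circleDomain,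
    Real.volume_real_Ioc_of_le (by positivity)]
  push_cast
  simp
  ring

theorem bdryChar_ne_zero (n : ℤ) : M.bdryChar s e n ≠ 0 := by
  intro h
  have h1 := M.inner_bdryChar_self s e n
  rw [h, inner_zero_left] at h1
  have h2 := M.f_at_pos e
  have h3 : 0 < 2 * Real.pi * M.f (M.pos e) := by positivity
  exact h3.ne (by exact_mod_cast h1)

theorem isClosed_H1Bdry : IsClosed (M.H1Bdry s e : Set (M.L2Bdry e × M.L2Bdry e)) := by
  obtain ⟨C, hC, hle⟩ := M.exists_lebesgue_le_bdry e
  have : (M.H1Bdry s e : Set (M.L2Bdry e × M.L2Bdry e)) = ⋂ (χ : ℝ → ℂ) (_ : s.IsCircleSection χ),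
      {x | (∫ θ in circleDomain, x.1 θ * deriv χ θ)
        + ∫ θ in circleDomain, x.2 θ * χ θ = 0} := by
    ext x
    simp [H1Bdry]
  rw [this]
  refine isClosed_iInter fun χ => isClosed_iInter fun hχ => isClosed_eq ?_ continuous_const
  have h0 := memLp_circle hχ.1.continuous
  have h1 := memLp_circle (hχ.1.continuous_deriv (by simp))
  exact ((LpAux.continuous_integral_mul hC hle h1).comp continuous_fst).add
    ((LpAux.continuous_integral_mul hC hle h0).comp continuous_snd)

instance : CompleteSpace (M.H1Bdry s e) := (M.isClosed_H1Bdry s e).completeSpace_coe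

/-- The conjugate character is an admissible test section, so the weak derivative acts as a Fourier
multiplier on the whole domain, not only on finite sums. -/
theorem inner_bdryDθ (n : ℤ) (x : M.H1Bdry s e) :
    inner ℂ (M.bdryChar s e n) (M.bdryDθ s e x)
      = I * s.freq n * inner ℂ (M.bdryChar s e n) (M.bdryIncl s e x) := by
  have h := x.2 _ (s.isCircleSection_conj_char n)
  simp only [(s.hasDerivAt_conj_char n _).deriv] at h
  rw [inner_bdryChar, inner_bdryChar]
  have h1 : ∫ θ in circleDomain, (x : M.L2Bdry e × M.L2Bdry e).1 θ
        * (-(I * s.freq n) * (starRingEnd ℂ) (s.char n θ))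
      = -(I * s.freq n) * ∫ θ in circleDomain, (x : M.L2Bdry e × M.L2Bdry e).1 θ
        * (starRingEnd ℂ) (s.char n θ) := by
    rw [← integral_const_mul]
    congr 1 with θ
    ring
  rw [h1] at h
  change _ * ∫ θ in circleDomain, (x : M.L2Bdry e × M.L2Bdry e).2 θ * _
    = _ * (_ * ∫ θ in circleDomain, (x : M.L2Bdry e × M.L2Bdry e).1 θ * _)
  linear_combination (M.f (M.pos e) : ℂ) * h

/-- The factor in front of `-i ∂_θ + A` in the chiral endpoint operator. -/
def bdryFactor (ν : NormalConvention) (e : Endpoint) : ℝ :=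
  -(normalCoeff ν e).re / M.f (M.pos e)

theorem bdryFactor_ne_zero (ν : NormalConvention) : M.bdryFactor ν e ≠ 0 := by
  have := (M.f_at_pos e).ne'
  unfold bdryFactor
  cases ν <;> cases e <;> simp [normalCoeff, this]

/-- The matrix `-i γ(N) γ₂` is diagonal and its lower entry is minus the coefficient of `N`. Thus
the inward normal gives `-1/f(0)` at the left end and `1/f(T)` at the right. -/
theorem boundaryPlus_apply (ν : NormalConvention) (x : M.H1Bdry s e) :
    M.boundaryPlus s A ν e x
      = (M.bdryFactor ν e : ℂ) • ((-I) • M.bdryDθ s e x + (A : ℂ) • M.bdryIncl s e x) := by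
  have hn : (((normalCoeff ν e).re : ℝ) : ℂ) = normalCoeff ν e := by
    cases ν <;> cases e <;> simp [normalCoeff]
  have h : boundaryClifford ν e 1 1 = -normalCoeff ν e := by
    simp [boundaryClifford, gamma1, gamma2]
    linear_combination normalCoeff ν e * I_mul_I
  simp only [boundaryPlus, boundaryDirac, matAct, compwise, inclPlus, tangential,
    ContinuousLinearMap.comp_apply, ContinuousLinearMap.proj_apply, ContinuousLinearMap.pi_apply,
    Fin.sum_univ_two, add_apply, smul_apply,
    ContinuousLinearMap.single_apply, Pi.single_eq_same, h]
  simp only [ne_eq, zero_ne_one, not_false_eq_true, Pi.single_eq_of_ne, map_zero, smul_zero,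
    add_zero, zero_add]
  rw [smul_smul]
  congr 1
  rw [bdryFactor]
  push_cast
  rw [hn]
  ring

/-- The eigenvalues of the chiral endpoint operator. -/
def bdryEigenvalue (ν : NormalConvention) (e : Endpoint) (n : ℤ) : ℝ :=
  M.bdryFactor ν e * (s.freq n + A)

/-- This plays the part of self-adjointness: injectivity and the description of all eigenspaces are
read off coefficientwise from it. -/
theorem inner_boundaryPlus (ν : NormalConvention) (n : ℤ) (x : M.H1Bdry s e) :
    inner ℂ (M.bdryChar s e n) (M.boundaryPlus s A ν e x)
      = M.bdryEigenvalue s A ν e n * inner ℂ (M.bdryChar s e n) (M.bdryIncl s e x) := by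
  rw [boundaryPlus_apply, inner_smul_right, inner_add_right, inner_smul_right, inner_smul_right,
    inner_bdryDθ, bdryEigenvalue]
  push_cast
  linear_combination (-(M.bdryFactor ν e : ℂ) * s.freq n
    * inner ℂ (M.bdryChar s e n) (M.bdryIncl s e x)) * I_mul_I

theorem bdryChar_mem_H1Bdry (n : ℤ) :
    (M.bdryChar s e n, (I * s.freq n) • M.bdryChar s e n) ∈ M.H1Bdry s e := by
  intro χ hχ
  obtain ⟨C, hC, hle⟩ := M.exists_lebesgue_le_bdry e
  have dχ : ∀ θ, HasDerivAt χ (deriv χ θ) θ := fun θ =>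
    (hχ.1.differentiable (by simp)).differentiableAt.hasDerivAt
  have h1 : ∫ θ in circleDomain, M.bdryChar s e n θ * deriv χ θ
      = ∫ θ in circleDomain, s.char n θ * deriv χ θ := by
    refine integral_congr_ae ?_
    filter_upwards [M.coeFn_bdryChar s e n] with θ h
    rw [h]
  have h2 : ∫ θ in circleDomain, M.bdryChar s e n θ * χ θ
      = ∫ θ in circleDomain, s.char n θ * χ θ := by
    refine integral_congr_ae ?_
    filter_upwards [M.coeFn_bdryChar s e n] with θ h
    rw [h]
  dsimp only
  rw [LpAux.integral_smul_mul hle, h1, h2]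
  exact s.integral_char_mul_deriv n dχ (hχ.1.continuous_deriv (by simp)) (by simpa using hχ.2 0)

/-- A character as an element of `H¹` of a boundary component. -/
def bdryCharH1 (n : ℤ) : M.H1Bdry s e := ⟨_, M.bdryChar_mem_H1Bdry s e n⟩

@[simp] theorem bdryIncl_bdryCharH1 (n : ℤ) :
    M.bdryIncl s e (M.bdryCharH1 s e n) = M.bdryChar s e n := rfl

@[simp] theorem bdryDθ_bdryCharH1 (n : ℤ) :
    M.bdryDθ s e (M.bdryCharH1 s e n) = (I * s.freq n) • M.bdryChar s e n := rfl

theorem boundaryPlus_bdryCharH1 (ν : NormalConvention) (n : ℤ) :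
    M.boundaryPlus s A ν e (M.bdryCharH1 s e n)
      = (M.bdryEigenvalue s A ν e n : ℂ) • M.bdryChar s e n := by
  rw [boundaryPlus_apply, bdryIncl_bdryCharH1, bdryDθ_bdryCharH1, smul_smul, ← add_smul,
    smul_smul, bdryEigenvalue]
  congr 1
  push_cast
  linear_combination (-(M.bdryFactor ν e : ℂ) * s.freq n) * I_mul_I

theorem bdryIncl_injective {x : M.H1Bdry s e} (h : M.bdryIncl s e x = 0) : x = 0 := by
  refine Subtype.ext (Prod.ext h (M.bdry_ext s e fun n => ?_))
  have := M.inner_bdryDθ s e n x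
  rwa [h, inner_zero_right, mul_zero] at this

end WarpedCylinder

/-! ### Invertibility and spectrum of the endpoint operators -/

namespace WarpedCylinder

variable (M : WarpedCylinder) (s : SpinStructure) (A : ℝ) (e : Endpoint) (ν : NormalConvention)

theorem exists_gap (hA : ∀ n, s.freq n + A ≠ 0) : ∃ δ > 0, ∀ n, δ ≤ |s.freq n + A| := by
  obtain ⟨δ, h0, h⟩ := exists_pos_le_abs_int_add (x := s.shift + A) fun n => by
    rw [← add_assoc]
    exact hA n
  exact ⟨δ, h0, fun n => by simpa only [SpinStructure.freq, add_assoc] using h n⟩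

/-- The gap absorbs the constant `A`, so `∂_θ` is controlled by `-i ∂_θ + A` with a constant that
does not depend on the mode. -/
theorem abs_freq_le {δ : ℝ} (h0 : 0 < δ) (n : ℤ) (h : δ ≤ |s.freq n + A|) :
    |s.freq n| ≤ (1 + |A| / δ) * |s.freq n + A| := by
  have h1 : |s.freq n| ≤ |s.freq n + A| + |A| := by
    simpa using abs_sub (s.freq n + A) A
  have h2 : |A| ≤ |A| / δ * |s.freq n + A| := by
    rw [div_mul_eq_mul_div, le_div_iff₀ h0]
    exact mul_le_mul_of_nonneg_left h (abs_nonneg A)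
  linarith

theorem bdryEigenvalue_ne_zero (hA : ∀ n, s.freq n + A ≠ 0) (n : ℤ) :
    M.bdryEigenvalue s A ν e n ≠ 0 :=
  mul_ne_zero (M.bdryFactor_ne_zero e ν) (hA n)

theorem bdryEigenvalue_injective : Function.Injective (M.bdryEigenvalue s A ν e) := by
  intro n m h
  have := mul_left_cancel₀ (M.bdryFactor_ne_zero e ν) h
  simpa [SpinStructure.freq] using this

theorem boundaryPlus_injective (hA : ∀ n, s.freq n + A ≠ 0) {x : M.H1Bdry s e}
    (h : M.boundaryPlus s A ν e x = 0) : x = 0 := by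
  refine M.bdryIncl_injective s e (M.bdry_ext s e fun n => ?_)
  have := M.inner_boundaryPlus s A e ν n x
  rw [h, inner_zero_right, eq_comm, mul_eq_zero] at this
  exact this.resolve_left (by exact_mod_cast M.bdryEigenvalue_ne_zero s A e ν hA n)

/-- On the `n`-th character the section is bounded through the gap (`C₁`) and its derivative through
`abs_freq_le` (`C₂`). Orthogonality extends both bounds to finite sums, and completeness of the
characters gives totality. -/
theorem exists_boundaryPlus_eq (hA : ∀ n, s.freq n + A ≠ 0) :
    ∃ C : ℝ, ∀ y, ∃ x, M.boundaryPlus s A ν e x = y ∧ ‖x‖ ≤ C * ‖y‖ := by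
  obtain ⟨δ, hδ, hgap⟩ := exists_gap s A hA
  have hb : 0 < |M.bdryFactor ν e| := abs_pos.2 (M.bdryFactor_ne_zero e ν)
  set C₁ : ℝ := (|M.bdryFactor ν e| * δ)⁻¹ with hC₁
  set C₂ : ℝ := (1 + |A| / δ) / |M.bdryFactor ν e| with hC₂
  have p1 : 0 ≤ C₁ := by positivity
  have p2 : 0 ≤ C₂ := by positivity
  have key : ∀ n, ∀ x ∈ Submodule.span ℂ {M.bdryCharH1 s e n}, ∃ c : ℂ,
      M.bdryIncl s e x = c • M.bdryChar s e n ∧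
      M.bdryDθ s e x = (c * (I * s.freq n)) • M.bdryChar s e n ∧
      M.boundaryPlus s A ν e x = (c * M.bdryEigenvalue s A ν e n) • M.bdryChar s e n := by
    intro n x hx
    obtain ⟨c, rfl⟩ := Submodule.mem_span_singleton.1 hx
    exact ⟨c, by simp, by simp [smul_smul], by
      rw [map_smul, boundaryPlus_bdryCharH1, smul_smul]⟩
  have orth : ∀ n m, n ≠ m → ∀ a b : ℂ,
      inner ℂ (a • M.bdryChar s e n) (b • M.bdryChar s e m) = 0 := by
    intro n m h a b
    rw [inner_smul_left, inner_smul_right, M.inner_bdryChar_of_ne s e h, mul_zero, mul_zero]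
  refine ⟨max C₁ C₂, exists_preimage_of_total (M.boundaryPlus s A ν e)
    (fun n => Submodule.span ℂ {M.bdryCharH1 s e n}) (le_max_of_le_left p1) ?_ ?_⟩
  · intro S x hx
    choose c h1 h2 h3 using fun n => key n (x n) (hx n)
    have l1 : ‖M.bdryIncl s e (∑ n ∈ S, x n)‖ ≤ C₁ * ‖M.boundaryPlus s A ν e (∑ n ∈ S, x n)‖ := by
      refine norm_map_sum_le_of_orthogonal _ _ p1 S x (fun n m h => ?_) (fun n m h => ?_)
        fun n => ?_
      · rw [h1, h1, orth n m h]
      · rw [h3, h3, orth n m h]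
      · rw [h1, h3, norm_smul, norm_smul, norm_mul, norm_real, Real.norm_eq_abs, bdryEigenvalue,
          abs_mul]
        have : 1 ≤ C₁ * (|M.bdryFactor ν e| * |s.freq n + A|) := by
          rw [hC₁, inv_mul_eq_div, one_le_div (by positivity)]
          exact mul_le_mul_of_nonneg_left (hgap n) hb.le
        nlinarith [mul_nonneg (norm_nonneg (c n)) (norm_nonneg (M.bdryChar s e n))]
    have l2 : ‖M.bdryDθ s e (∑ n ∈ S, x n)‖ ≤ C₂ * ‖M.boundaryPlus s A ν e (∑ n ∈ S, x n)‖ := by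
      refine norm_map_sum_le_of_orthogonal _ _ p2 S x (fun n m h => ?_) (fun n m h => ?_)
        fun n => ?_
      · rw [h2, h2, orth n m h]
      · rw [h3, h3, orth n m h]
      · rw [h2, h3, norm_smul, norm_smul, norm_mul, norm_mul, norm_mul, norm_real, norm_real,
          Real.norm_eq_abs, Real.norm_eq_abs, norm_I, one_mul, bdryEigenvalue, abs_mul]
        have : |s.freq n| ≤ C₂ * (|M.bdryFactor ν e| * |s.freq n + A|) := by
          rw [hC₂, ← mul_assoc, div_mul_cancel₀ _ hb.ne']
          exact abs_freq_le s A hδ n (hgap n)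
        calc ‖c n‖ * |s.freq n| * ‖M.bdryChar s e n‖
            ≤ ‖c n‖ * (C₂ * (|M.bdryFactor ν e| * |s.freq n + A|)) * ‖M.bdryChar s e n‖ := by
              gcongr
          _ = _ := by ring
    -- The norm on `H¹(Y)` is the sup norm inherited from the product, so the two components are
    -- bounded separately.
    have hmax : ‖∑ n ∈ S, x n‖
        = max ‖M.bdryIncl s e (∑ n ∈ S, x n)‖ ‖M.bdryDθ s e (∑ n ∈ S, x n)‖ := rfl
    rw [hmax]
    refine max_le (l1.trans ?_) (l2.trans ?_)
    · exact mul_le_mul_of_nonneg_right (le_max_left _ _) (norm_nonneg _)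
    · exact mul_le_mul_of_nonneg_right (le_max_right _ _) (norm_nonneg _)
  · intro y hy
    refine M.bdry_ext s e fun n => ?_
    have := hy n _ (Submodule.mem_span_singleton_self _)
    rw [boundaryPlus_bdryCharH1, inner_smul_left, mul_eq_zero] at this
    refine this.resolve_left ?_
    rw [conj_ofReal]
    exact_mod_cast M.bdryEigenvalue_ne_zero s A e ν hA n

theorem isInvertibleOp_boundaryPlus (hA : ∀ n, s.freq n + A ≠ 0) :
    IsInvertibleOp (M.bdryIncl s e) (M.boundaryPlus s A ν e) := by
  obtain ⟨C, hC⟩ := M.exists_boundaryPlus_eq s A e ν hA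
  have inj : Function.Injective (M.boundaryPlus s A ν e) :=
    (injective_iff_map_eq_zero _).2 fun x => M.boundaryPlus_injective s A e ν hA
  refine ⟨⟨inj, fun y => ?_⟩, C, fun x => ?_⟩
  · obtain ⟨x, hx, _⟩ := hC y
    exact ⟨x, hx⟩
  -- By injectivity the controlled preimage of `B x` is `x` itself.
  · obtain ⟨x', hx', h⟩ := hC (M.boundaryPlus s A ν e x)
    rw [inj hx'] at h
    exact (le_max_left _ _ : ‖M.bdryIncl s e x‖ ≤ ‖x‖).trans h

/-! ### Eigenspaces and spectral projections -/

theorem inner_eigenspace {μ : ℝ} {y : M.L2Bdry e}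
    (hy : y ∈ eigenspaceOp (M.bdryIncl s e) (M.boundaryPlus s A ν e) μ) (n : ℤ)
    (h : M.bdryEigenvalue s A ν e n ≠ μ) : inner ℂ (M.bdryChar s e n) y = 0 := by
  obtain ⟨x, hx, rfl⟩ := hy
  have hx' : M.boundaryPlus s A ν e x = (μ : ℂ) • M.bdryIncl s e x := sub_eq_zero.1 hx
  have h1 := M.inner_boundaryPlus s A e ν n x
  rw [hx', inner_smul_right] at h1
  have h2 : ((M.bdryEigenvalue s A ν e n : ℂ) - μ)
      * inner ℂ (M.bdryChar s e n) (M.bdryIncl s e x) = 0 := by linear_combination -h1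
  exact (mul_eq_zero.1 h2).resolve_left (sub_ne_zero.2 (by exact_mod_cast h))

theorem eigenspace_eq_bot {μ : ℝ} (h : ∀ n, M.bdryEigenvalue s A ν e n ≠ μ) :
    eigenspaceOp (M.bdryIncl s e) (M.boundaryPlus s A ν e) μ = ⊥ :=
  (Submodule.eq_bot_iff _).2 fun _ hy =>
    M.bdry_ext s e fun n => M.inner_eigenspace s A e ν hy n (h n)

theorem bdryChar_mem_eigenspace (n : ℤ) :
    M.bdryChar s e n ∈ eigenspaceOp (M.bdryIncl s e) (M.boundaryPlus s A ν e)
      (M.bdryEigenvalue s A ν e n) :=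
  ⟨M.bdryCharH1 s e n, sub_eq_zero.2 (M.boundaryPlus_bdryCharH1 s A e ν n), rfl⟩

/-- Distinct modes have distinct eigenvalues, so an eigenvector has only one nonzero Fourier
coefficient and equals its projection onto that character. -/
theorem eigenspace_eq_span (n : ℤ) :
    eigenspaceOp (M.bdryIncl s e) (M.boundaryPlus s A ν e) (M.bdryEigenvalue s A ν e n)
      = Submodule.span ℂ {M.bdryChar s e n} := by
  refine le_antisymm (fun y hy => ?_)
    ((Submodule.span_singleton_le_iff_mem _ _).2 (M.bdryChar_mem_eigenspace s A e ν n))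
  have hne : inner ℂ (M.bdryChar s e n) (M.bdryChar s e n) ≠ 0 :=
    inner_self_ne_zero.2 (M.bdryChar_ne_zero s e n)
  refine Submodule.mem_span_singleton.2
    ⟨inner ℂ (M.bdryChar s e n) y / inner ℂ (M.bdryChar s e n) (M.bdryChar s e n), ?_⟩
  refine (sub_eq_zero.1 (M.bdry_ext s e fun m => ?_)).symm
  rw [inner_sub_right, inner_smul_right]
  by_cases h : m = n
  · subst h
    rw [div_mul_cancel₀ _ hne, sub_self]
  · rw [M.inner_bdryChar_of_ne s e h, mul_zero, sub_zero]
    exact M.inner_eigenspace s A e ν hy m fun h' => h (M.bdryEigenvalue_injective s A e ν h')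

theorem finrank_eigenspace (n : ℤ) :
    Module.finrank ℂ (eigenspaceOp (M.bdryIncl s e) (M.boundaryPlus s A ν e)
      (M.bdryEigenvalue s A ν e n)) = 1 := by
  rw [eigenspace_eq_span, finrank_span_singleton (M.bdryChar_ne_zero s e n)]

theorem finiteDimensional_eigenspace (μ : ℝ) :
    FiniteDimensional ℂ (eigenspaceOp (M.bdryIncl s e) (M.boundaryPlus s A ν e) μ) := by
  by_cases h : ∃ n, M.bdryEigenvalue s A ν e n = μ
  · obtain ⟨n, rfl⟩ := h
    rw [eigenspace_eq_span]
    infer_instance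
  · rw [M.eigenspace_eq_bot s A e ν (not_exists.1 h)]
    infer_instance

/-- Such a character is orthogonal to every positive eigenspace. Passing to the closed span does not
change the orthogonal complement. -/
theorem positiveProj_bdryChar {n : ℤ} (h : M.bdryEigenvalue s A ν e n < 0) :
    positiveProj (M.bdryIncl s e) (M.boundaryPlus s A ν e) (M.bdryChar s e n) = 0 := by
  rw [positiveProj, Submodule.starProjection_apply_eq_zero_iff, positiveSpace,
    Submodule.orthogonal_closure, Submodule.mem_orthogonal']
  intro y hy
  induction hy using Submodule.iSup_induction' with
  | mem μ y hy => exact M.inner_eigenspace s A e ν hy n (h.trans μ.2).ne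
  | zero => exact inner_zero_right _
  | add x y _ _ hx hy => rw [inner_add_right, hx, hy, add_zero]

theorem inner_bdryChar_eq_zero_of_positiveProj {n : ℤ} (h : 0 < M.bdryEigenvalue s A ν e n)
    {y : M.L2Bdry e} (hy : positiveProj (M.bdryIncl s e) (M.boundaryPlus s A ν e) y = 0) :
    inner ℂ (M.bdryChar s e n) y = 0 := by
  rw [positiveProj, Submodule.starProjection_apply_eq_zero_iff] at hy
  refine (Submodule.mem_orthogonal _ _).1 hy _ (Submodule.le_topologicalClosure _ ?_)
  exact Submodule.mem_iSup_of_mem (⟨_, h⟩ : {μ : ℝ // 0 < μ})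
    (M.bdryChar_mem_eigenspace s A e ν n)

/-! ### The `η`-invariant -/

/-- The analytic continuation of the `η`-series of the chiral endpoint operator. -/
def etaFunction (z : ℂ) : ℂ :=
  (SignType.sign (M.bdryFactor ν e) : ℝ) * ((|M.bdryFactor ν e| : ℝ) : ℂ) ^ (-z)
    * (2 * HurwitzZeta.hurwitzZetaOdd ((s.shift + A : ℝ) : UnitAddCircle) z)

theorem differentiable_etaFunction : Differentiable ℂ (M.etaFunction s A e ν) := by
  have hb : ((|M.bdryFactor ν e| : ℝ) : ℂ) ≠ 0 := by
    exact_mod_cast abs_ne_zero.2 (M.bdryFactor_ne_zero e ν)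
  unfold etaFunction
  refine ((differentiable_const _).mul ?_).mul
    ((differentiable_const _).mul (HurwitzZeta.differentiable_hurwitzZetaOdd _))
  exact differentiable_neg.const_cpow (Or.inl hb)

/-- Multiplicities vanish off the values `c (n + shift + A)` and equal 1 on them, so the series over
nonzero reals is a series over `ℤ`, from which sign and modulus of `c` factor out. -/
theorem hasSum_etaFunction (hA : ∀ n, s.freq n + A ≠ 0) {z : ℂ} (hz : 1 < z.re) :
    HasSum (fun μ : {μ : ℝ // μ ≠ 0} =>
      (Module.finrank ℂ (eigenspaceOp (M.bdryIncl s e) (M.boundaryPlus s A ν e) μ) : ℂ)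
        * ((SignType.sign (μ : ℝ) : ℝ) : ℂ) * ((|(μ : ℝ)| : ℝ) : ℂ) ^ (-z))
      (M.etaFunction s A e ν z) := by
  let g : ℤ → {μ : ℝ // μ ≠ 0} := fun n =>
    ⟨M.bdryEigenvalue s A ν e n, M.bdryEigenvalue_ne_zero s A e ν hA n⟩
  have hg : Function.Injective g := fun n m h =>
    M.bdryEigenvalue_injective s A e ν (Subtype.ext_iff.1 h)
  rw [← hg.hasSum_iff]
  -- The odd Hurwitz zeta function is normalized as half of the sum over `ℤ`; hence the factor 2.
  · have h := (HurwitzZeta.hasSum_int_hurwitzZetaOdd (s.shift + A) hz).mul_left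
      (((SignType.sign (M.bdryFactor ν e) : ℝ) : ℂ)
        * ((|M.bdryFactor ν e| : ℝ) : ℂ) ^ (-z) * 2)
    rw [mul_assoc _ (2 : ℂ)] at h
    refine h.congr_fun fun n => ?_
    have hsum : (n : ℝ) + (s.shift + A) = s.freq n + A := by
      rw [SpinStructure.freq, add_assoc]
    simp only [Function.comp_apply, g, M.finrank_eigenspace s A e ν n, hsum]
    rw [bdryEigenvalue, sign_mul, abs_mul, ofReal_mul,
      mul_cpow_ofReal_nonneg (abs_nonneg _) (abs_nonneg _), cpow_neg ((|s.freq n + A| : ℝ) : ℂ)]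
    have hsign : ∀ ε : SignType, ((ε : ℝ) : ℂ) = ε := fun ε => by cases ε <;> simp
    rw [SignType.coe_mul, ofReal_mul, hsign (SignType.sign (s.freq n + A))]
    simp
    ring
  · intro μ hμ
    rw [M.eigenspace_eq_bot s A e ν fun n h => hμ ⟨n, Subtype.ext h⟩]
    simp

theorem hasReducedEta_boundaryPlus (hA : ∀ n, s.freq n + A ≠ 0) :
    HasReducedEta (M.bdryIncl s e) (M.boundaryPlus s A ν e) (M.etaFunction s A e ν 0 / 2) := by
  refine ⟨M.finiteDimensional_eigenspace s A e ν 0, M.etaFunction s A e ν 0,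
    ⟨fun μ _ => M.finiteDimensional_eigenspace s A e ν μ, M.etaFunction s A e ν, 1,
      fun z hz => M.hasSum_etaFunction s A e ν hA hz,
      fun z => ((M.differentiable_etaFunction s A e ν).analyticAt z).meromorphicAt,
      (M.differentiable_etaFunction s A e ν).analyticAt 0, rfl⟩, ?_⟩
  rw [M.eigenspace_eq_bot s A e ν (M.bdryEigenvalue_ne_zero s A e ν hA)]
  simp

/-- At `z = 0` the power of the scale is 1, so different values of `f` at the two ends are
invisible; the opposite signs of the factors then cancel the two terms. -/
theorem etaFunction_add_etaFunction :
    M.etaFunction s A .left ν 0 + M.etaFunction s A .right ν 0 = 0 := by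
  have h0 := M.f_at_pos .left
  have h1 := M.f_at_pos .right
  cases ν <;> simp [etaFunction, bdryFactor, normalCoeff, neg_div, sign_pos, h0, h1]

end WarpedCylinder

namespace WarpedCylinder

variable (M : WarpedCylinder) (s : SpinStructure) (A : ℝ)

/-! ## Fourier analysis on the cylinder -/

/-- The extension of `f` by constants. -/
def fExt : ℝ → ℝ := IccExtend M.T_pos.le fun t : Icc 0 M.T => M.f t

/-- The extension of `f' / 2f` by constants. -/
def aExt : ℝ → ℝ := IccExtend M.T_pos.le fun t : Icc 0 M.T => M.fDeriv t / (2 * M.f t)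

variable {M} in
theorem fExt_eq {t : ℝ} (ht : t ∈ Icc 0 M.T) : M.fExt t = M.f t := IccExtend_of_mem _ _ ht

variable {M} in
theorem aExt_eq {t : ℝ} (ht : t ∈ Icc 0 M.T) : M.aExt t = M.fDeriv t / (2 * M.f t) :=
  IccExtend_of_mem _ (fun t : Icc 0 M.T => M.fDeriv t / (2 * M.f t)) ht

theorem fExt_pos (t : ℝ) : 0 < M.fExt t := M.f_pos _ (projIcc 0 M.T M.T_pos.le t).2

theorem continuous_fExt : Continuous M.fExt :=
  (continuousOn_iff_continuous_domRestrict.1 M.f_smooth.continuousOn).Icc_extend'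

theorem continuous_aExt : Continuous M.aExt :=
  (continuousOn_iff_continuous_domRestrict.1 M.continuousOn_fDeriv_div).Icc_extend'

theorem ae_carrier_mem : ∀ᵐ p ∂volume.restrict M.carrier, p ∈ M.carrier :=
  ae_restrict_mem M.measurableSet_carrier

theorem vol_eq : M.vol
    = (volume.restrict M.carrier).withDensity fun p => ENNReal.ofReal (M.fExt p.1) := by
  refine withDensity_congr_ae ?_
  filter_upwards [M.ae_carrier_mem] with p hp
  rw [fExt_eq hp.1]

theorem integral_vol (G : ℝ × ℝ → ℂ) :
    ∫ p, G p ∂M.vol = ∫ p in M.carrier, (M.fExt p.1 : ℂ) * G p := by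
  have hm : Measurable fun p : ℝ × ℝ => ENNReal.ofReal (M.fExt p.1) :=
    (M.continuous_fExt.measurable.comp measurable_fst).ennreal_ofReal
  rw [vol_eq, integral_withDensity_eq_integral_toReal_smul hm (by simp)]
  congr 1 with p
  rw [ENNReal.toReal_ofReal (M.fExt_pos _).le, real_smul]

theorem ae_of_ae_vol {p : ℝ × ℝ → Prop} (h : ∀ᵐ x ∂M.vol, p x) :
    ∀ᵐ x ∂volume.restrict M.carrier, p x := by
  obtain ⟨C, _, hle⟩ := M.exists_lebesgue_le_vol
  exact (Measure.absolutelyContinuous_of_le_smul hle).ae_le h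

theorem memLp_vol {φ : ℝ × ℝ → ℂ} (hφ : Continuous φ) : MemLp φ 2 M.vol := by
  obtain ⟨C, hC⟩ := M.exists_coeff_bound M.f_smooth.continuousOn
  refine (M.memLp_carrier hφ).of_measure_le_smul (c := ENNReal.ofReal C) ENNReal.ofReal_ne_top ?_
  rw [← withDensity_const]
  refine withDensity_mono ?_
  filter_upwards [M.ae_carrier_mem] with p hp
  exact ENNReal.ofReal_le_ofReal ((le_abs_self _).trans (hC _ hp.1))

theorem memLp_restrict (y : M.L2) : MemLp y 2 (volume.restrict M.carrier) := by
  obtain ⟨C, hC, hle⟩ := M.exists_lebesgue_le_vol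
  exact (Lp.memLp y).of_measure_le_smul hC hle

theorem isFiniteMeasure_restrict_carrier : IsFiniteMeasure (volume.restrict M.carrier) := by
  have hK : IsCompact (Icc 0 M.T ×ˢ Icc 0 (2 * Real.pi)) := isCompact_Icc.prod isCompact_Icc
  refine ⟨?_⟩
  rw [Measure.restrict_apply_univ]
  exact (measure_mono (prod_mono_right Ioc_subset_Icc_self)).trans_lt hK.measure_lt_top

theorem integrable_restrict (y : M.L2) : Integrable y (volume.restrict M.carrier) := by
  have := M.isFiniteMeasure_restrict_carrier
  exact (M.memLp_restrict y).integrable (by norm_num)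

theorem restrict_carrier : (volume.restrict M.carrier : Measure (ℝ × ℝ))
    = (volume.restrict (Icc 0 M.T)).prod (volume.restrict circleDomain) := by
  rw [Measure.prod_restrict, ← Measure.volume_eq_prod, carrier]

theorem continuous_mul_char {g : ℝ → ℂ} (hg : Continuous g) (n : ℤ) :
    Continuous fun p : ℝ × ℝ => g p.1 * s.char n p.2 :=
  (hg.comp continuous_fst).mul ((s.continuous_char n).comp continuous_snd)

theorem continuous_mul_conj_char {g : ℝ → ℂ} (hg : Continuous g) (n : ℤ) :
    Continuous fun p : ℝ × ℝ => g p.1 * (starRingEnd ℂ) (s.char n p.2) :=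
  (hg.comp continuous_fst).mul
    ((s.isCircleSection_conj_char n).1.continuous.comp continuous_snd)

/-- The section `g(t) exp(i k θ)` of `L²(M)`, for the `n`-th allowed mode `k`. -/
def modeL2 (n : ℤ) : C(ℝ, ℂ) →ₗ[ℂ] M.L2 where
  toFun g := (M.memLp_vol (continuous_mul_char s g.continuous n)).toLp
  map_add' g h := by
    rw [← MemLp.toLp_add]
    congr 1
    ext p
    simp [add_mul]
  map_smul' c g := by
    rw [RingHom.id_apply, ← MemLp.toLp_const_smul]
    congr 1
    ext p
    simp [mul_assoc]

theorem coeFn_modeL2 (n : ℤ) (g : C(ℝ, ℂ)) : ∀ᵐ p ∂volume.restrict M.carrier,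
    M.modeL2 s n g p = g p.1 * s.char n p.2 :=
  M.ae_of_ae_vol (M.memLp_vol (continuous_mul_char s g.continuous n)).coeFn_toLp

theorem inner_modeL2 (n : ℤ) (g : C(ℝ, ℂ)) (y : M.L2) : inner ℂ (M.modeL2 s n g) y
    = ∫ p in M.carrier, (M.fExt p.1 : ℂ) * (y p * (starRingEnd ℂ) (g p.1 * s.char n p.2)) := by
  rw [← integral_vol]
  exact LpAux.inner_toLp (M.memLp_vol (continuous_mul_char s g.continuous n)) y

theorem setIntegral_carrier {G : ℝ × ℝ → ℂ} (hG : Continuous G) :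
    ∫ p in M.carrier, G p = ∫ t in Icc 0 M.T, ∫ θ in circleDomain, G (t, θ) := by
  rw [M.restrict_carrier]
  refine integral_prod _ ?_
  rw [← M.restrict_carrier]
  have := M.isFiniteMeasure_restrict_carrier
  exact (M.memLp_carrier hG).integrable (by norm_num)

theorem inner_modeL2_modeL2 (n m : ℤ) (g h : C(ℝ, ℂ)) :
    inner ℂ (M.modeL2 s n g) (M.modeL2 s m h)
      = (∫ t in Icc 0 M.T, (M.fExt t : ℂ) * (h t * (starRingEnd ℂ) (g t)))
        * ∫ θ in circleDomain, s.char m θ * (starRingEnd ℂ) (s.char n θ) := by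
  have hf : Continuous fun t => (M.fExt t : ℂ) := continuous_ofReal.comp M.continuous_fExt
  have hg : Continuous fun t => (starRingEnd ℂ) (g t) := continuous_conj.comp g.continuous
  have hn := (s.isCircleSection_conj_char n).1.continuous
  have hm := s.continuous_char m
  have e : ∫ p in M.carrier, (M.fExt p.1 : ℂ) * (M.modeL2 s m h p
        * (starRingEnd ℂ) (g p.1 * s.char n p.2))
      = ∫ p in M.carrier, ((M.fExt p.1 : ℂ) * (h p.1 * (starRingEnd ℂ) (g p.1)))
        * (s.char m p.2 * (starRingEnd ℂ) (s.char n p.2)) := by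
    refine integral_congr_ae ?_
    filter_upwards [M.coeFn_modeL2 s m h] with p hp
    rw [hp, map_mul]
    ring
  rw [inner_modeL2, e, M.restrict_carrier]
  exact integral_prod_mul (fun t => (M.fExt t : ℂ) * (h t * (starRingEnd ℂ) (g t)))
    (fun θ => s.char m θ * (starRingEnd ℂ) (s.char n θ))

theorem inner_modeL2_of_ne {n m : ℤ} (hnm : n ≠ m) (g h : C(ℝ, ℂ)) :
    inner ℂ (M.modeL2 s n g) (M.modeL2 s m h) = 0 := by
  rw [inner_modeL2_modeL2, s.integral_char_mul_conj hnm.symm, mul_zero]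

theorem norm_modeL2_sq (n : ℤ) (g : C(ℝ, ℂ)) :
    ‖M.modeL2 s n g‖ ^ 2 = 2 * Real.pi * ∫ t in (0)..M.T, M.fExt t * ‖g t‖ ^ 2 := by
  have h1 : ∫ θ in circleDomain, s.char n θ * (starRingEnd ℂ) (s.char n θ)
      = ((2 * Real.pi : ℝ) : ℂ) := by
    simp_rw [s.char_mul_conj_self]
    rw [integral_const, measureReal_restrict_apply_univ, circleDomain,
      Real.volume_real_Ioc_of_le (by positivity)]
    simp
  have h2 : ∀ t, (M.fExt t : ℂ) * (g t * (starRingEnd ℂ) (g t))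
      = ((M.fExt t * ‖g t‖ ^ 2 : ℝ) : ℂ) := by
    intro t
    rw [mul_conj, normSq_eq_norm_sq]
    push_cast
    rfl
  have h3 : ((‖M.modeL2 s n g‖ ^ 2 : ℝ) : ℂ)
      = ((2 * Real.pi * ∫ t in (0)..M.T, M.fExt t * ‖g t‖ ^ 2 : ℝ) : ℂ) := by
    have := inner_self_eq_norm_sq_to_K (𝕜 := ℂ) (M.modeL2 s n g)
    rw [inner_modeL2_modeL2, h1] at this
    simp_rw [h2] at this
    rw [integral_complex_ofReal, integral_Icc_eq_integral_Ioc,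
      ← intervalIntegral.integral_of_le M.T_pos.le] at this
    push_cast at this ⊢
    rw [mul_comm (2 * (Real.pi : ℂ))]
    exact this.symm
  exact_mod_cast h3

/-! ### Fourier coefficients -/

/-- The `n`-th Fourier coefficient of a section, tested against `h(t)`. -/
def coef (n : ℤ) (h : ℝ → ℝ) (y : M.L2) : ℂ :=
  ∫ p in M.carrier, y p * ((h p.1 : ℂ) * (starRingEnd ℂ) (s.char n p.2))

variable {M s}

theorem continuous_test {h : ℝ → ℝ} (hh : Continuous h) (n : ℤ) :
    Continuous fun p : ℝ × ℝ => (h p.1 : ℂ) * (starRingEnd ℂ) (s.char n p.2) :=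
  continuous_mul_conj_char s (continuous_ofReal.comp hh) n

theorem coef_add {h : ℝ → ℝ} (hh : Continuous h) (n : ℤ) (y z : M.L2) :
    M.coef s n h (y + z) = M.coef s n h y + M.coef s n h z := by
  obtain ⟨C, hC, hle⟩ := M.exists_lebesgue_le_vol
  exact LpAux.integral_add_mul hC hle y z (M.memLp_carrier (continuous_test hh n))

theorem coef_smul (h : ℝ → ℝ) (n : ℤ) (c : ℂ) (y : M.L2) :
    M.coef s n h (c • y) = c * M.coef s n h y := by
  obtain ⟨C, _, hle⟩ := M.exists_lebesgue_le_vol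
  exact LpAux.integral_smul_mul hle c y _

theorem coef_zero (h : ℝ → ℝ) (n : ℤ) : M.coef s n h 0 = 0 := by
  simpa using coef_smul (M := M) (s := s) h n 0 0

theorem integrable_coef {h : ℝ → ℝ} (hh : Continuous h) (n : ℤ) (y : M.L2) :
    Integrable (fun p => y p * ((h p.1 : ℂ) * (starRingEnd ℂ) (s.char n p.2)))
      (volume.restrict M.carrier) := by
  obtain ⟨C, hC, hle⟩ := M.exists_lebesgue_le_vol
  exact LpAux.integrable_mul hC hle y (M.memLp_carrier (continuous_test hh n))

theorem coef_add_left {g h : ℝ → ℝ} (hg : Continuous g) (hh : Continuous h) (n : ℤ) (y : M.L2) :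
    M.coef s n (fun t => g t + h t) y = M.coef s n g y + M.coef s n h y := by
  unfold coef
  rw [← integral_add (integrable_coef hg n y) (integrable_coef hh n y)]
  congr 1 with p
  push_cast
  ring

theorem coef_const_mul (c : ℝ) (h : ℝ → ℝ) (n : ℤ) (y : M.L2) :
    M.coef s n (fun t => c * h t) y = c * M.coef s n h y := by
  unfold coef
  rw [← integral_const_mul]
  congr 1 with p
  push_cast
  ring

/-- Coefficients move onto the test function, where they are replaced by a globally defined
extension `b`; this leads to differential equations on the whole line. -/
theorem coef_mulCoeff {a : ℝ → ℝ} (ha : ContinuousOn a (Icc 0 M.T)) {b : ℝ → ℝ}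
    (hab : ∀ t ∈ Icc 0 M.T, b t = a t) (h : ℝ → ℝ) (n : ℤ) (y : M.L2) :
    M.coef s n h (M.mulCoeff a ha y) = M.coef s n (fun t => b t * h t) y := by
  refine integral_congr_ae ?_
  filter_upwards [M.ae_of_ae_vol (M.memLp_coeff_mul ha y).coeFn_toLp, M.ae_carrier_mem] with p hp hm
  change (M.memLp_coeff_mul ha y).toLp _ p * _ = _
  rw [hp, hab _ hm.1]
  push_cast
  ring

theorem norm_coef_sub_le {g h : ℝ → ℝ} (hg : Continuous g) (hh : Continuous h) {ε : ℝ}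
    (hgh : ∀ t ∈ Icc 0 M.T, |g t - h t| ≤ ε) (n : ℤ) (y : M.L2) :
    ‖M.coef s n g y - M.coef s n h y‖ ≤ ε * ∫ p in M.carrier, ‖y p‖ := by
  unfold coef
  rw [← integral_sub (integrable_coef hg n y) (integrable_coef hh n y), ← integral_const_mul]
  refine norm_integral_le_of_norm_le ((M.integrable_restrict y).norm.const_mul ε) ?_
  filter_upwards [M.ae_carrier_mem] with p hp
  rw [← mul_sub, ← sub_mul, ← ofReal_sub, norm_mul, norm_mul, RCLike.norm_conj, s.norm_char,
    norm_real, mul_one, mul_comm]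
  exact mul_le_mul_of_nonneg_right (hgh _ hp.1) (norm_nonneg _)

/-- The inner product uses `f dt dθ` while `coef` uses `dt dθ`; the extra factor is the density. -/
theorem inner_modeL2_ofReal {h : ℝ → ℝ} (hh : Continuous h) (n : ℤ) (y : M.L2) :
    inner ℂ (M.modeL2 s n ⟨fun t => (h t : ℂ), continuous_ofReal.comp hh⟩) y
      = M.coef s n (fun t => M.fExt t * h t) y := by
  rw [inner_modeL2, coef]
  congr 1 with p
  simp only [ContinuousMap.coe_mk, map_mul, conj_ofReal]
  push_cast
  ring

/-- A square-integrable section all of whose Fourier coefficients vanish is zero. -/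
theorem eq_zero_of_coef {y : M.L2} (hy : ∀ n, ∀ h : ℝ → ℝ, Continuous h → M.coef s n h y = 0) :
    y = 0 := by
  have := M.isFiniteMeasure_restrict_carrier
  have e := M.restrict_carrier
  set μ₁ : Measure ℝ := volume.restrict (Icc 0 M.T)
  set μ₂ : Measure ℝ := volume.restrict circleDomain
  have hy2 : Integrable (fun p => ‖y p‖ ^ 2) (μ₁.prod μ₂) := by
    rw [← e]
    exact (memLp_two_iff_integrable_sq_norm (M.memLp_restrict y).aestronglyMeasurable).1
      (M.memLp_restrict y)
  have hym : AEStronglyMeasurable y (μ₁.prod μ₂) := e ▸ (M.memLp_restrict y).aestronglyMeasurable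
  -- Testing in `t` kills the `n`-th coefficient of almost every slice; there are only countably
  -- many `n`. Completeness on the circle then kills the slices, and Fubini the section.
  have hcoef : ∀ᵐ t ∂μ₁, ∀ n, ∫ θ, y (t, θ) * (starRingEnd ℂ) (s.char n θ) ∂μ₂ = 0 := by
    rw [ae_all_iff]
    intro n
    have hi : Integrable (fun p : ℝ × ℝ => y p * (starRingEnd ℂ) (s.char n p.2)) (μ₁.prod μ₂) := by
      have := integrable_coef (M := M) (s := s) (h := fun _ => 1) continuous_const n y
      rw [e] at this
      simpa using this
    refine ae_eq_zero_of_integral_contDiff_smul_eq_zero hi.integral_prod_left.locallyIntegrable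
      fun g hg _ => ?_
    have h0 := hy n g hg.continuous
    have hi' := integrable_coef (M := M) (s := s) hg.continuous n y
    rw [coef, e] at h0
    rw [e] at hi'
    rw [integral_prod _ hi'] at h0
    rw [← h0]
    congr 1 with t
    rw [real_smul, ← integral_const_mul]
    congr 1 with θ
    ring
  have hslice : ∀ᵐ t ∂μ₁, ∫ θ, ‖y (t, θ)‖ ^ 2 ∂μ₂ = 0 := by
    filter_upwards [hcoef, hy2.prod_right_ae, hym.prodMk_left] with t h1 h2 h3
    have := s.ae_eq_zero_of_fourier ((memLp_two_iff_integrable_sq_norm h3).2 h2) h1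
    refine integral_eq_zero_of_ae ?_
    filter_upwards [this] with θ hθ
    simp [hθ]
  have htot : ∫ p, ‖y p‖ ^ 2 ∂(μ₁.prod μ₂) = 0 := by
    rw [integral_prod _ hy2]
    exact integral_eq_zero_of_ae hslice
  rw [integral_eq_zero_iff_of_nonneg (fun _ => by positivity) hy2, ← e] at htot
  refine Lp.eq_zero_iff_ae_eq_zero.2 (M.vol_ac.ae_le ?_)
  filter_upwards [htot] with p hp
  simpa using hp

end WarpedCylinder

/-! ### Derivatives of products and slices -/

theorem fderiv_fst_mul_snd {a b : ℝ → ℂ} {a' b' : ℂ} {p : ℝ × ℝ} (ha : HasDerivAt a a' p.1)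
    (hb : HasDerivAt b b' p.2) :
    fderiv ℝ (fun p : ℝ × ℝ => a p.1 * b p.2) p (1, 0) = a' * b p.2 ∧
    fderiv ℝ (fun p : ℝ × ℝ => a p.1 * b p.2) p (0, 1) = a p.1 * b' := by
  have h1 := ha.hasFDerivAt.comp p (hasFDerivAt_fst (𝕜 := ℝ) (p := p))
  have h2 := hb.hasFDerivAt.comp p (hasFDerivAt_snd (𝕜 := ℝ) (p := p))
  have h := (h1.mul h2).fderiv
  have e : (a ∘ Prod.fst * b ∘ Prod.snd : ℝ × ℝ → ℂ) = fun p => a p.1 * b p.2 := rfl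
  rw [e] at h
  rw [h]
  constructor <;> simp [mul_comm]

theorem hasDerivAt_slice_fst {φ : ℝ × ℝ → ℂ} (hφ : ContDiff ℝ ∞ φ) (t θ : ℝ) :
    HasDerivAt (fun t => φ (t, θ)) (fderiv ℝ φ (t, θ) (1, 0)) t := by
  have h1 : HasFDerivAt φ (fderiv ℝ φ (t, θ)) (t, θ) :=
    (hφ.differentiable (by simp) (t, θ)).hasFDerivAt
  exact h1.comp_hasDerivAt t ((hasDerivAt_id t).prodMk (hasDerivAt_const t θ))

theorem hasDerivAt_slice_snd {φ : ℝ × ℝ → ℂ} (hφ : ContDiff ℝ ∞ φ) (t θ : ℝ) :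
    HasDerivAt (fun θ => φ (t, θ)) (fderiv ℝ φ (t, θ) (0, 1)) θ := by
  have h1 : HasFDerivAt φ (fderiv ℝ φ (t, θ)) (t, θ) :=
    (hφ.differentiable (by simp) (t, θ)).hasFDerivAt
  exact h1.comp_hasDerivAt θ ((hasDerivAt_const θ t).prodMk (hasDerivAt_id θ))

/-- Pairs `(u, u')` of a continuously differentiable function and its derivative. -/
def C1Pair : Submodule ℂ (C(ℝ, ℂ) × C(ℝ, ℂ)) where
  carrier := {x | ∀ t, HasDerivAt x.1 (x.2 t) t}
  add_mem' hx hy t := (hx t).add (hy t)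
  zero_mem' t := hasDerivAt_const t 0
  smul_mem' c _ hx t := (hx t).const_smul c

/-! ### Completeness of `H¹(M)` -/

namespace WarpedCylinder

variable (M : WarpedCylinder) (s : SpinStructure) (A : ℝ)

theorem isClosed_H1 : IsClosed
    (M.H1 s : Set (M.L2 × M.L2 × M.L2 × M.L2Bdry .left × M.L2Bdry .right)) := by
  obtain ⟨C, hC, hle⟩ := M.exists_lebesgue_le_vol
  obtain ⟨C₀, hC₀, hle₀⟩ := M.exists_lebesgue_le_bdry .left
  obtain ⟨C₁, hC₁, hle₁⟩ := M.exists_lebesgue_le_bdry .right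
  have : (M.H1 s : Set (M.L2 × M.L2 × M.L2 × M.L2Bdry .left × M.L2Bdry .right))
      = ⋂ (φ : ℝ × ℝ → ℂ) (_ : s.IsCylinderSection φ), {x |
    ((∫ p in M.carrier, x.1 p * fderiv ℝ φ p (1, 0)) + (∫ p in M.carrier, x.2.1 p * φ p)
      = (∫ θ in circleDomain, x.2.2.2.2 θ * φ (M.T, θ))
        - ∫ θ in circleDomain, x.2.2.2.1 θ * φ (0, θ)) ∧
    (∫ p in M.carrier, x.1 p * fderiv ℝ φ p (0, 1)) + (∫ p in M.carrier, x.2.2.1 p * φ p)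
      = 0} := by
    ext x
    simp [H1]
  rw [this]
  refine isClosed_iInter fun φ => isClosed_iInter fun hφ => ?_
  have hc := hφ.1.continuous
  have hd : Continuous (fderiv ℝ φ) := hφ.1.continuous_fderiv (by simp)
  have h0 := LpAux.continuous_integral_mul hC hle (M.memLp_carrier hc)
  have h1 := LpAux.continuous_integral_mul hC hle
    (M.memLp_carrier (hd.clm_apply (continuous_const (y := ((1 : ℝ), (0 : ℝ))))))
  have h2 := LpAux.continuous_integral_mul hC hle
    (M.memLp_carrier (hd.clm_apply (continuous_const (y := ((0 : ℝ), (1 : ℝ))))))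
  have b0 := LpAux.continuous_integral_mul hC₀ hle₀
    (memLp_circle (hc.comp (by fun_prop : Continuous fun θ : ℝ => ((0 : ℝ), θ))))
  have b1 := LpAux.continuous_integral_mul hC₁ hle₁
    (memLp_circle (hc.comp (by fun_prop : Continuous fun θ : ℝ => (M.T, θ))))
  refine IsClosed.inter (isClosed_eq ?_ ?_) (isClosed_eq ?_ continuous_const)
  · exact (h1.comp continuous_fst).add (h0.comp (continuous_fst.comp continuous_snd))
  · exact (b1.comp (continuous_snd.comp (continuous_snd.comp
      (continuous_snd.comp continuous_snd)))).sub (b0.comp (continuous_fst.comp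
        (continuous_snd.comp (continuous_snd.comp continuous_snd))))
  · exact (h2.comp continuous_fst).add (h0.comp
      (continuous_fst.comp (continuous_snd.comp continuous_snd)))

instance : CompleteSpace (M.H1 s) := (M.isClosed_H1 s).completeSpace_coe

/-! ## Single-mode sections in `H¹` -/

/-- Green's formula in `t` is the fundamental theorem of calculus on each circle angle after Fubini;
in `θ` it is `integral_char_mul_deriv` on each slice. One continuous derivative of `u` is enough. -/
theorem mode_mem_H1 (n : ℤ) (x : C1Pair) :
    (M.modeL2 s n x.1.1, M.modeL2 s n x.1.2, (I * s.freq n) • M.modeL2 s n x.1.1,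
      x.1.1 0 • M.bdryChar s .left n, x.1.1 M.T • M.bdryChar s .right n) ∈ M.H1 s := by
  obtain ⟨⟨u, h⟩, hu⟩ := x
  have hu' : ∀ t, HasDerivAt u (h t) t := hu
  intro φ hφ
  obtain ⟨C, hC, hle⟩ := M.exists_lebesgue_le_vol
  obtain ⟨C₀, hC₀, hle₀⟩ := M.exists_lebesgue_le_bdry .left
  obtain ⟨C₁, hC₁, hle₁⟩ := M.exists_lebesgue_le_bdry .right
  have hc := hφ.1.continuous
  have hd : Continuous (fderiv ℝ φ) := hφ.1.continuous_fderiv (by simp)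
  have hd1 : Continuous fun p => fderiv ℝ φ p (1, 0) := hd.clm_apply continuous_const
  have hd2 : Continuous fun p => fderiv ℝ φ p (0, 1) := hd.clm_apply continuous_const
  have cu := continuous_mul_char s u.continuous n
  have ch := continuous_mul_char s h.continuous n
  have key : ∀ (g : C(ℝ, ℂ)) (ψ : ℝ × ℝ → ℂ), ∫ p in M.carrier, M.modeL2 s n g p * ψ p
      = ∫ p in M.carrier, g p.1 * s.char n p.2 * ψ p := by
    intro g ψ
    refine integral_congr_ae ?_
    filter_upwards [M.coeFn_modeL2 s n g] with p hp
    rw [hp]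
  have keyb : ∀ (e : Endpoint) (ψ : ℝ → ℂ), ∫ θ in circleDomain, M.bdryChar s e n θ * ψ θ
      = ∫ θ in circleDomain, s.char n θ * ψ θ := by
    intro e ψ
    refine integral_congr_ae ?_
    filter_upwards [M.coeFn_bdryChar s e n] with p hp
    rw [hp]
  dsimp only
  rw [LpAux.integral_smul_mul hle, LpAux.integral_smul_mul hle₀, LpAux.integral_smul_mul hle₁,
    key, key, key, key, keyb, keyb]
  have := M.isFiniteMeasure_restrict_carrier
  have int : ∀ {G : ℝ × ℝ → ℂ}, Continuous G → Integrable G (volume.restrict M.carrier) :=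
    fun hG => (M.memLp_carrier hG).integrable (by norm_num)
  have cu1 : Continuous fun p : ℝ × ℝ => u p.1 * s.char n p.2 * fderiv ℝ φ p (1, 0) := cu.mul hd1
  have ch0 : Continuous fun p : ℝ × ℝ => h p.1 * s.char n p.2 * φ p := ch.mul hc
  have cu2 : Continuous fun p : ℝ × ℝ => u p.1 * s.char n p.2 * fderiv ℝ φ p (0, 1) := cu.mul hd2
  have cu0 : Continuous fun p : ℝ × ℝ => I * s.freq n * (u p.1 * s.char n p.2 * φ p) :=
    continuous_const.mul (cu.mul hc)
  have c1 : Continuous fun p : ℝ × ℝ =>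
      u p.1 * s.char n p.2 * fderiv ℝ φ p (1, 0) + h p.1 * s.char n p.2 * φ p := cu1.add ch0
  have c2 : Continuous fun p : ℝ × ℝ => u p.1 * s.char n p.2 * fderiv ℝ φ p (0, 1)
      + I * s.freq n * (u p.1 * s.char n p.2 * φ p) := cu2.add cu0
  constructor
  · rw [← integral_add (int cu1) (int ch0), M.setIntegral_carrier c1,
      integral_integral_swap]
    · rw [← integral_const_mul, ← integral_const_mul, ← integral_sub]
      · refine integral_congr_ae (Filter.Eventually.of_forall fun θ => ?_)
        beta_reduce
        rw [integral_Icc_eq_integral_Ioc, ← intervalIntegral.integral_of_le M.T_pos.le]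
        rw [intervalIntegral.integral_eq_sub_of_hasDerivAt
          (f := fun t => u t * s.char n θ * φ (t, θ))]
        · ring
        · intro t _
          refine (((hu' t).mul_const _).mul (hasDerivAt_slice_fst hφ.1 t θ)).congr_deriv ?_
          ring
        · have : Continuous fun t : ℝ => u t * s.char n θ * fderiv ℝ φ (t, θ) (1, 0)
              + h t * s.char n θ * φ (t, θ) :=
            c1.comp (by fun_prop : Continuous fun t : ℝ => (t, θ))
          exact this.intervalIntegrable _ _
      · have : Continuous fun θ : ℝ => u M.T * (s.char n θ * φ (M.T, θ)) :=
          continuous_const.mul ((s.continuous_char n).mul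
            (hc.comp (by fun_prop : Continuous fun θ : ℝ => (M.T, θ))))
        exact this.integrableOn_Ioc
      · have : Continuous fun θ : ℝ => u 0 * (s.char n θ * φ (0, θ)) :=
          continuous_const.mul ((s.continuous_char n).mul
            (hc.comp (by fun_prop : Continuous fun θ : ℝ => ((0 : ℝ), θ))))
        exact this.integrableOn_Ioc
    · have := int c1
      rw [M.restrict_carrier] at this
      exact this
  · rw [← integral_const_mul, ← integral_add (int cu2) (int cu0),
      M.setIntegral_carrier c2]
    refine integral_eq_zero_of_ae (Filter.Eventually.of_forall fun t => ?_)
    have hcθ : Continuous fun θ : ℝ => (t, θ) := by fun_prop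
    have hn := s.continuous_char n
    have h0 := s.integral_char_mul_deriv n (fun θ => hasDerivAt_slice_snd hφ.1 t θ)
      (hd2.comp hcθ) (by simpa using hφ.2 t 0)
    have i1 : IntegrableOn (fun θ => s.char n θ * fderiv ℝ φ (t, θ) (0, 1)) circleDomain :=
      (hn.mul (hd2.comp hcθ)).integrableOn_Ioc
    have i2 : IntegrableOn (fun θ => I * s.freq n * (s.char n θ * φ (t, θ))) circleDomain :=
      (continuous_const.mul (hn.mul (hc.comp hcθ))).integrableOn_Ioc
    rw [← integral_const_mul, ← integral_add i1 i2] at h0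
    have h1 := congrArg (fun z => u t * z) h0
    simp only [mul_zero] at h1
    rw [← integral_const_mul] at h1
    refine Eq.trans ?_ h1
    beta_reduce
    congr 1 with θ
    ring

/-- The section `u(t) exp(i k θ)` of `H¹(M)`, for the `n`-th allowed mode `k`. -/
def modeH1 (n : ℤ) : C1Pair →ₗ[ℂ] M.H1 s where
  toFun x := ⟨_, M.mode_mem_H1 s n x⟩
  map_add' x y := by
    refine Subtype.ext ?_
    simp [add_smul]
  map_smul' c x := by
    refine Subtype.ext ?_
    simp [smul_smul, smul_comm c, mul_comm c]

@[simp] theorem incl_modeH1 (n : ℤ) (x : C1Pair) :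
    M.incl s (M.modeH1 s n x) = M.modeL2 s n x.1.1 := rfl

@[simp] theorem dt_modeH1 (n : ℤ) (x : C1Pair) :
    M.dt s (M.modeH1 s n x) = M.modeL2 s n x.1.2 := rfl

@[simp] theorem dθ_modeH1 (n : ℤ) (x : C1Pair) :
    M.dθ s (M.modeH1 s n x) = (I * s.freq n) • M.modeL2 s n x.1.1 := rfl

theorem trace_modeH1 (e : Endpoint) (n : ℤ) (x : C1Pair) :
    M.trace s e (M.modeH1 s n x) = x.1.1 (M.pos e) • M.bdryChar s e n := by
  cases e <;> rfl

/-! ## The Fourier coefficients of `H¹` sections -/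

variable {M s}

theorem tendsto_coef {w : ℕ → ℝ → ℝ} {h : ℝ → ℝ} (hw : ∀ k, Continuous (w k)) (hh : Continuous h)
    {B : ℝ} (hwh : ∀ k, ∀ t ∈ Icc 0 M.T, |w k t - h t| ≤ B * (1 / ((k : ℝ) + 1))) (n : ℤ)
    (y : M.L2) :
    Filter.Tendsto (fun k => M.coef s n (w k) y) Filter.atTop (nhds (M.coef s n h y)) := by
  rw [tendsto_iff_norm_sub_tendsto_zero]
  refine squeeze_zero (fun _ => norm_nonneg _)
    (fun k => norm_coef_sub_le (hw k) hh (hwh k) n y) ?_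
  have := ((tendsto_one_div_add_atTop_nhds_zero_nat (𝕜 := ℝ)).const_mul B).mul_const
    (∫ p in M.carrier, ‖y p‖)
  simpa using this

/-- The space `H¹` is defined by smooth test sections, but the test functions needed later solve
equations with merely continuous coefficients. Uniform approximation on `[0,T]` closes the
difference. -/
theorem exists_contDiff_approx {h : ℝ → ℝ} (hh : Continuous h) (T : ℝ) :
    ∃ q : ℕ → ℝ → ℝ, (∀ k, ContDiff ℝ ∞ (q k)) ∧
      ∀ k, ∀ t ∈ Icc 0 T, |q k t - h t| ≤ 1 / ((k : ℝ) + 1) := by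
  choose q h1 h2 using fun k : ℕ =>
    exists_contDiff_near (T := T) hh (ε := 1 / ((k : ℝ) + 1)) (by positivity)
  exact ⟨q, h1, fun k t ht => (h2 k t ht).le⟩

theorem isCylinderSection_test {v : ℝ → ℝ} (hv : ContDiff ℝ ∞ v) (n : ℤ) :
    s.IsCylinderSection fun p => (v p.1 : ℂ) * (starRingEnd ℂ) (s.char n p.2) := by
  refine ⟨?_, fun t θ => ?_⟩
  · exact ((ofRealCLM.contDiff.comp hv).comp contDiff_fst).mul
      ((s.isCircleSection_conj_char n).1.comp contDiff_snd)
  · have := (s.isCircleSection_conj_char n).2 θ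
    beta_reduce at this ⊢
    rw [this]
    ring

theorem coef_dθ {v : ℝ → ℝ} (hv : Continuous v) (n : ℤ) (x : M.H1 s) :
    M.coef s n v (M.dθ s x) = I * s.freq n * M.coef s n v (M.incl s x) := by
  have smooth : ∀ q : ℝ → ℝ, ContDiff ℝ ∞ q →
      M.coef s n q (M.dθ s x) = I * s.freq n * M.coef s n q (M.incl s x) := by
    intro q hq
    have h := (x.2 _ (isCylinderSection_test (s := s) hq n)).2
    have e : ∀ p : ℝ × ℝ, fderiv ℝ (fun p : ℝ × ℝ => (q p.1 : ℂ) * (starRingEnd ℂ) (s.char n p.2)) p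
        (0, 1) = (q p.1 : ℂ) * (-(I * s.freq n) * (starRingEnd ℂ) (s.char n p.2)) := fun p =>
      (fderiv_fst_mul_snd (a := fun t => (q t : ℂ))
        (hq.differentiable (by simp) p.1).hasDerivAt.ofReal_comp (s.hasDerivAt_conj_char n p.2)).2
    simp only [e] at h
    have h1 : ∫ p in M.carrier, (x : M.L2 × M.L2 × M.L2 × M.L2Bdry .left × M.L2Bdry .right).1 p
          * ((q p.1 : ℂ) * (-(I * s.freq n) * (starRingEnd ℂ) (s.char n p.2)))
        = -(I * s.freq n) * M.coef s n q (M.incl s x) := by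
      rw [coef, ← integral_const_mul]
      congr 1 with p
      change _ = _ * ((x : M.L2 × M.L2 × M.L2 × M.L2Bdry .left × M.L2Bdry .right).1 p * _)
      ring
    rw [h1] at h
    change -(I * s.freq n) * M.coef s n q (M.incl s x) + M.coef s n q (M.dθ s x) = 0 at h
    linear_combination h
  obtain ⟨q, h1, h2⟩ := exists_contDiff_approx hv M.T
  have h2' : ∀ k, ∀ t ∈ Icc 0 M.T, |q k t - v t| ≤ 1 * (1 / ((k : ℝ) + 1)) := by simpa using h2
  refine tendsto_nhds_unique (tendsto_coef (fun k => (h1 k).continuous) hv h2' n (M.dθ s x)) ?_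
  simp only [fun k => smooth (q k) (h1 k)]
  exact (tendsto_coef (fun k => (h1 k).continuous) hv h2' n (M.incl s x)).const_mul _

theorem coef_dt {v h : ℝ → ℝ} (hh : Continuous h) (hv : ∀ t, HasDerivAt v (h t) t) (n : ℤ)
    (x : M.H1 s) :
    M.coef s n h (M.incl s x) + M.coef s n v (M.dt s x)
      = v M.T * (∫ θ in circleDomain, M.trace s .right x θ * (starRingEnd ℂ) (s.char n θ))
        - v 0 * ∫ θ in circleDomain, M.trace s .left x θ * (starRingEnd ℂ) (s.char n θ) := by
  have smooth : ∀ q w : ℝ → ℝ, Continuous q → ContDiff ℝ ∞ w → (∀ t, HasDerivAt w (q t) t) →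
      M.coef s n q (M.incl s x) + M.coef s n w (M.dt s x)
      = w M.T * (∫ θ in circleDomain, M.trace s .right x θ * (starRingEnd ℂ) (s.char n θ))
        - w 0 * ∫ θ in circleDomain, M.trace s .left x θ * (starRingEnd ℂ) (s.char n θ) := by
    intro q w hq hw hd
    have h := (x.2 _ (isCylinderSection_test (s := s) hw n)).1
    have e : ∀ p : ℝ × ℝ, fderiv ℝ (fun p : ℝ × ℝ => (w p.1 : ℂ) * (starRingEnd ℂ) (s.char n p.2)) p
        (1, 0) = (q p.1 : ℂ) * (starRingEnd ℂ) (s.char n p.2) := fun p =>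
      (fderiv_fst_mul_snd (a := fun t => (w t : ℂ))
        (hd p.1).ofReal_comp (s.hasDerivAt_conj_char n p.2)).1
    simp only [e] at h
    refine h.trans ?_
    rw [← integral_const_mul, ← integral_const_mul]
    congr 2
    · ext θ
      exact mul_left_comm _ _ _
    · ext θ
      exact mul_left_comm _ _ _
  obtain ⟨q, h1, h2⟩ := exists_contDiff_approx hh M.T
  have h2' : ∀ k, ∀ t ∈ Icc 0 M.T, |q k t - h t| ≤ 1 * (1 / ((k : ℝ) + 1)) := by simpa using h2
  have hvc : Continuous v := continuous_iff_continuousAt.2 fun t => (hv t).continuousAt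
  -- The derivative is approximated and then integrated, so that `w k` and its derivative converge
  -- together; integration over `[0,t]` costs a factor `T`.
  set w : ℕ → ℝ → ℝ := fun k t => v 0 + ∫ r in (0)..t, q k r with hw
  have dw : ∀ k t, HasDerivAt (w k) (q k t) t := fun k t =>
    ((h1 k).continuous.integral_hasStrictDerivAt 0 t).hasDerivAt.const_add _
  have cw : ∀ k, ContDiff ℝ ∞ (w k) := fun k => by
    refine (contDiff_infty_iff_deriv).2 ⟨fun t => (dw k t).differentiableAt, ?_⟩
    rw [show deriv (w k) = q k from funext fun t => (dw k t).deriv]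
    exact h1 k
  have wv : ∀ k, ∀ t ∈ Icc 0 M.T, |w k t - v t| ≤ M.T * (1 / ((k : ℝ) + 1)) := by
    intro k t ht
    have e1 : v t = v 0 + ∫ r in (0)..t, h r := by
      rw [intervalIntegral.integral_eq_sub_of_hasDerivAt (fun t _ => hv t)
        (hh.intervalIntegrable _ _)]
      ring
    rw [e1, hw, add_sub_add_left_eq_sub, ← intervalIntegral.integral_sub
      ((h1 k).continuous.intervalIntegrable _ _) (hh.intervalIntegrable _ _)]
    have := intervalIntegral.norm_integral_le_of_norm_le_const (a := 0) (b := t)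
      (f := fun r => q k r - h r) (C := 1 / ((k : ℝ) + 1)) fun r hr => by
        rw [uIoc_of_le ht.1] at hr
        exact h2 k r ⟨hr.1.le, hr.2.trans ht.2⟩
    rw [sub_zero, abs_of_nonneg ht.1, Real.norm_eq_abs, mul_comm] at this
    exact this.trans (mul_le_mul_of_nonneg_right ht.2 (by positivity))
  have hend : ∀ t ∈ Icc 0 M.T, Filter.Tendsto (fun k => (w k t : ℂ)) Filter.atTop
      (nhds (v t : ℂ)) := by
    intro t ht
    rw [tendsto_iff_norm_sub_tendsto_zero]
    refine squeeze_zero (fun _ => norm_nonneg _) (fun k => ?_)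
      (by simpa using (tendsto_one_div_add_atTop_nhds_zero_nat (𝕜 := ℝ)).const_mul M.T)
    rw [← ofReal_sub, norm_real]
    simpa using wv k t ht
  refine tendsto_nhds_unique
    ((tendsto_coef (fun k => (h1 k).continuous) hh h2' n (M.incl s x)).add
      (tendsto_coef (fun k => (cw k).continuous) hvc wv n (M.dt s x))) ?_
  simp only [fun k => smooth (q k) (w k) (h1 k).continuous (cw k) (dw k)]
  exact ((hend _ (M.pos_mem .right)).mul_const _).sub ((hend _ (M.pos_mem .left)).mul_const _)

end WarpedCylinder

namespace WarpedCylinder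

variable (M : WarpedCylinder) (s : SpinStructure) (A : ℝ) (ν : NormalConvention)

/-! ## The chiral Dirac operator on Fourier modes -/

/-- Only the upper right entries of `γ₁` and `γ₂` lead from `S⁺` to the upper component. The lower
diagonal entry `-i` of `γ₁ γ₂` turns the spin connection into the term `+f'/2f`. -/
theorem diracPlus_apply (x : M.H1 s) : M.diracPlus s A x
    = I • (M.dt s x + M.mulCoeff (fun t => M.fDeriv t / (2 * M.f t)) M.continuousOn_fDeriv_div
        (M.incl s x)
      + M.mulCoeff (fun t => 1 / M.f t) M.continuousOn_inv_f
        ((-I) • M.dθ s x + (A : ℂ) • M.incl s x)) := by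
  have h10 : (gamma1 * gamma2) 1 0 = 0 := by simp [gamma1, gamma2]
  have h11 : (gamma1 * gamma2) 1 1 = -I := by simp [gamma1, gamma2]
  have g1 : gamma1 0 1 = 1 := rfl
  have g2 : gamma2 0 1 = -I := rfl
  have g1' : gamma1 0 0 = 0 := rfl
  have g2' : gamma2 0 0 = 0 := rfl
  have e : (A : ℂ) • M.incl s x = (-I) • ((I * (A : ℂ)) • M.incl s x) := by
    rw [smul_smul]
    congr 1
    linear_combination (A : ℂ) * I_mul_I
  rw [e, ← smul_add, map_smul]
  simp only [diracPlus, dirac, nabla1, nabla2, matAct, compwise, inclPlus,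
    ContinuousLinearMap.comp_apply, ContinuousLinearMap.proj_apply, ContinuousLinearMap.pi_apply,
    Fin.sum_univ_two, add_apply, smul_apply, sub_apply, Pi.sub_apply, Pi.add_apply, Pi.smul_apply,
    ContinuousLinearMap.single_apply, Pi.single_eq_same, h10, h11, g1, g2, g1', g2', zero_smul,
    zero_add, one_smul]
  congr 1
  rw [add_assoc]
  congr 1
  rw [smul_sub, smul_smul, neg_mul_neg, I_mul_I]
  module

/-- The zeroth-order coefficient of the chiral Dirac operator on the `n`-th mode. -/
def modeCoeff (n : ℤ) (t : ℝ) : ℝ := M.aExt t + (s.freq n + A) * (M.fExt t)⁻¹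

theorem continuous_inv_fExt : Continuous fun t => (M.fExt t)⁻¹ :=
  M.continuous_fExt.inv₀ fun t => (M.fExt_pos t).ne'

theorem continuous_modeCoeff (n : ℤ) : Continuous (M.modeCoeff s A n) :=
  M.continuous_aExt.add (continuous_const.mul M.continuous_inv_fExt)

theorem inv_fExt_eq {t : ℝ} (ht : t ∈ Icc 0 M.T) : (M.fExt t)⁻¹ = 1 / M.f t := by
  rw [fExt_eq ht, one_div]

/-- This is the weak form of the mode equation for an arbitrary `H¹` section, with all zeroth-order
terms carried by the test function. -/
theorem coef_diracPlus {v : ℝ → ℝ} (hv : Continuous v) (n : ℤ) (x : M.H1 s) :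
    M.coef s n v (M.diracPlus s A x) = I * (M.coef s n v (M.dt s x)
      + M.coef s n (fun t => M.modeCoeff s A n t * v t) (M.incl s x)) := by
  have ca : Continuous fun t => M.aExt t * v t := M.continuous_aExt.mul hv
  have cq : Continuous fun t => (M.fExt t)⁻¹ * v t := M.continuous_inv_fExt.mul hv
  have cq' : Continuous fun t => (s.freq n + A) * ((M.fExt t)⁻¹ * v t) := continuous_const.mul cq
  have e : (fun t => M.modeCoeff s A n t * v t)
      = fun t => M.aExt t * v t + (s.freq n + A) * ((M.fExt t)⁻¹ * v t) := by
    ext t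
    rw [modeCoeff]
    ring
  rw [diracPlus_apply, coef_smul, coef_add hv, coef_add hv,
    coef_mulCoeff M.continuousOn_fDeriv_div (fun t ht => aExt_eq ht),
    coef_mulCoeff M.continuousOn_inv_f (fun t ht => M.inv_fExt_eq ht), coef_add cq, coef_smul,
    coef_smul, coef_dθ cq, e, coef_add_left ca cq', coef_const_mul]
  push_cast
  linear_combination (-I * s.freq n * M.coef s n (fun t => (M.fExt t)⁻¹ * v t) (M.incl s x))
    * I_mul_I

theorem mulCoeff_modeL2 {a : ℝ → ℝ} (ha : ContinuousOn a (Icc 0 M.T)) {b : ℝ → ℝ}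
    (hb : Continuous b) (hab : ∀ t ∈ Icc 0 M.T, b t = a t) (n : ℤ) (g : C(ℝ, ℂ)) :
    M.mulCoeff a ha (M.modeL2 s n g)
      = M.modeL2 s n (⟨fun t => (b t : ℂ), continuous_ofReal.comp hb⟩ * g) := by
  refine Lp.ext ?_
  have h1 := (M.memLp_coeff_mul ha (M.modeL2 s n g)).coeFn_toLp
  have h2 := (M.memLp_vol (continuous_mul_char s g.continuous n)).coeFn_toLp
  have h3 := (M.memLp_vol (continuous_mul_char s
    (⟨fun t => (b t : ℂ), continuous_ofReal.comp hb⟩ * g : C(ℝ, ℂ)).continuous n)).coeFn_toLp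
  filter_upwards [h1, h2, h3, M.ae_vol_mem] with p h1 h2 h3 hp
  refine h1.trans (Eq.trans ?_ h3.symm)
  refine (congrArg (fun z => (a p.1 : ℂ) * z) h2).trans ?_
  rw [← hab _ hp.1]
  exact (mul_assoc _ _ _).symm

/-- The function `u' + (f' / 2f) u`. -/
def modeP (x : C1Pair) : C(ℝ, ℂ) :=
  x.1.2 + ⟨fun t => (M.aExt t : ℂ), continuous_ofReal.comp M.continuous_aExt⟩ * x.1.1

/-- The chiral Dirac operator on the `n`-th mode, without the factor `i`. -/
def modeDirac (n : ℤ) (x : C1Pair) : C(ℝ, ℂ) :=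
  M.modeP x + ((s.freq n + A : ℝ) : ℂ) •
    (⟨fun t => ((M.fExt t)⁻¹ : ℝ), continuous_ofReal.comp M.continuous_inv_fExt⟩ * x.1.1)

theorem diracPlus_modeH1 (n : ℤ) (x : C1Pair) :
    M.diracPlus s A (M.modeH1 s n x) = I • M.modeL2 s n (M.modeDirac s A n x) := by
  have e : (-I) • ((I * (s.freq n : ℂ)) • M.modeL2 s n x.1.1) + (A : ℂ) • M.modeL2 s n x.1.1
      = ((s.freq n + A : ℝ) : ℂ) • M.modeL2 s n x.1.1 := by
    rw [smul_smul, ← add_smul]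
    congr 1
    push_cast
    linear_combination (-(s.freq n : ℂ)) * I_mul_I
  rw [diracPlus_apply, incl_modeH1, dt_modeH1, dθ_modeH1, e, map_smul,
    M.mulCoeff_modeL2 s M.continuousOn_fDeriv_div M.continuous_aExt (fun t ht => aExt_eq ht),
    M.mulCoeff_modeL2 s M.continuousOn_inv_f M.continuous_inv_fExt (fun t ht => M.inv_fExt_eq ht),
    modeDirac, modeP, map_add, map_add, map_smul]

/-! ### Injectivity -/

/-- A harmonic section vanishes if each of its modes vanishes at one end of the cylinder. -/
theorem eq_zero_of_diracPlus_eq_zero {x : M.H1 s} (hx : M.diracPlus s A x = 0)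
    (htr : ∀ n, ∃ e, inner ℂ (M.bdryChar s e n) (M.trace s e x) = 0) : x = 0 := by
  set b : Endpoint → ℤ → ℂ := fun e n =>
    ∫ θ in circleDomain, M.trace s e x θ * (starRingEnd ℂ) (s.char n θ) with hb
  have hinner : ∀ e n, inner ℂ (M.bdryChar s e n) (M.trace s e x) = M.f (M.pos e) * b e n :=
    fun e n => M.inner_bdryChar s e n _
  have hb0 : ∀ n, ∃ e, b e n = 0 := by
    intro n
    obtain ⟨e, he⟩ := htr n
    rw [hinner, mul_eq_zero] at he
    exact ⟨e, he.resolve_left (by exact_mod_cast (M.f_at_pos e).ne')⟩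
  -- Duality: for `v` solving the adjoint equation with right side `h`, Green's formula and `D⁺ x =
  -- 0` reduce the pairing with `h` to boundary terms.
  have green : ∀ n (h v : ℝ → ℝ), Continuous h →
      (∀ t, HasDerivAt v (M.modeCoeff s A n t • v t + h t) t) →
      M.coef s n h (M.incl s x) = v M.T * b .right n - v 0 * b .left n := by
    intro n h v hh hv
    have cv : Continuous v := continuous_iff_continuousAt.2 fun t => (hv t).continuousAt
    have cc : Continuous fun t => M.modeCoeff s A n t * v t :=
      (M.continuous_modeCoeff s A n).mul cv
    have h1 := coef_dt (M := M) (s := s) (h := fun t => M.modeCoeff s A n t * v t + h t)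
      (cc.add hh) hv n x
    have h2 := M.coef_diracPlus s A cv n x
    rw [hx, coef_zero, eq_comm, mul_eq_zero] at h2
    have h3 := h2.resolve_left I_ne_zero
    rw [coef_add_left cc hh] at h1
    rw [← h1]
    linear_combination -h3
  -- A homogeneous adjoint solution equal to 1 at `e` transports the vanishing from the other end to
  -- `e`.
  have hball : ∀ e n, b e n = 0 := by
    intro e n
    obtain ⟨v, v1, hv⟩ := exists_hasDerivAt_linear (M.continuous_modeCoeff s A n)
      (h := fun _ => (0 : ℝ)) continuous_const (M.pos e) (1 : ℝ)
    have h := green n _ v continuous_const hv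
    have h0 : M.coef s n (fun _ => 0) (M.incl s x) = 0 := by simp [coef]
    rw [h0] at h
    obtain ⟨e', he'⟩ := hb0 n
    cases e <;> cases e' <;> first | exact he' | skip
    · simpa [he', show v 0 = 1 from v1] using h
    · simpa [he', show v M.T = 1 from v1] using h.symm
  -- Every continuous `h` occurs as a right side and the boundary terms are gone, so all
  -- coefficients vanish.
  have hincl : M.incl s x = 0 := by
    refine eq_zero_of_coef (s := s) fun n h hh => ?_
    obtain ⟨v, -, hv⟩ := exists_hasDerivAt_linear (M.continuous_modeCoeff s A n) hh 0 (0 : ℝ)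
    rw [green n h v hh hv, hball, hball, mul_zero, mul_zero, sub_zero]
  have hdt : M.dt s x = 0 := by
    refine eq_zero_of_coef (s := s) fun n v hv => ?_
    have h2 := M.coef_diracPlus s A hv n x
    rwa [hx, hincl, coef_zero, coef_zero, add_zero, eq_comm, mul_eq_zero,
      or_iff_right I_ne_zero] at h2
  have hdθ : M.dθ s x = 0 := by
    refine eq_zero_of_coef (s := s) fun n v hv => ?_
    rw [coef_dθ hv, hincl, coef_zero, mul_zero]
  have htrace : ∀ e, M.trace s e x = 0 := fun e =>
    M.bdry_ext s e fun n => by rw [hinner, hball, mul_zero]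
  exact Subtype.ext (Prod.ext hincl (Prod.ext hdt (Prod.ext hdθ
    (Prod.ext (htrace .left) (htrace .right)))))

/-! ### The APS condition on Fourier modes -/

/-- Exactly one of the two endpoint operators is positive on a given mode. -/
theorem exists_positive_end (hA : ∀ n, s.freq n + A ≠ 0) (n : ℤ) :
    ∃ e, 0 < M.bdryEigenvalue s A ν e n ∧
      ∀ e', e' ≠ e → M.bdryEigenvalue s A ν e' n < 0 := by
  have h0 := M.f_at_pos .left
  have h1 := M.f_at_pos .right
  -- The product of the two eigenvalues is the negative product of the factors times `l²`, whatever
  -- the sign of `l` and the choice of normal.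
  have key : M.bdryEigenvalue s A ν .left n * M.bdryEigenvalue s A ν .right n < 0 := by
    have h : M.bdryFactor ν .left * M.bdryFactor ν .right < 0 := by
      cases ν <;> simp [bdryFactor, normalCoeff, h0, h1, neg_div]
    have h2 : 0 < (s.freq n + A) ^ 2 := by
      have := hA n
      positivity
    calc _ = M.bdryFactor ν .left * M.bdryFactor ν .right * (s.freq n + A) ^ 2 := by
          unfold bdryEigenvalue
          ring
      _ < 0 := mul_neg_of_neg_of_pos h h2
  rcases mul_neg_iff.1 key with ⟨hl, hr⟩ | ⟨hl, hr⟩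
  · refine ⟨.left, hl, fun e' he' => ?_⟩
    cases e'
    · exact absurd rfl he'
    · exact hr
  · refine ⟨.right, hr, fun e' he' => ?_⟩
    cases e'
    · exact hl
    · exact absurd rfl he'

theorem mem_apsDomain {x : M.H1 s} : x ∈ M.apsDomain s A ν ↔
    ∀ e, positiveProj (M.bdryIncl s e) (M.boundaryPlus s A ν e) (M.trace s e x) = 0 := by
  refine ⟨fun h e => ?_, fun h => ⟨h .left, h .right⟩⟩
  cases e
  · exact h.1
  · exact h.2

/-- The nonlocal condition becomes a single scalar condition at `e`; at the other end the projection
annihilates the character. -/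
theorem modeH1_mem_apsDomain {n : ℤ} {e : Endpoint}
    (he : ∀ e', e' ≠ e → M.bdryEigenvalue s A ν e' n < 0) {x : C1Pair}
    (hx : x.1.1 (M.pos e) = 0) : M.modeH1 s n x ∈ M.apsDomain s A ν := by
  refine (M.mem_apsDomain s A ν).2 fun e' => ?_
  rw [trace_modeH1, map_smul]
  by_cases h : e' = e
  · rw [h, hx, zero_smul]
  · rw [M.positiveProj_bdryChar s A e' ν (he e' h), smul_zero]

theorem eq_zero_of_modeH1_mem_apsDomain {n : ℤ} {e : Endpoint}
    (he : 0 < M.bdryEigenvalue s A ν e n) {x : C1Pair}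
    (hx : M.modeH1 s n x ∈ M.apsDomain s A ν) : x.1.1 (M.pos e) = 0 := by
  have h := M.inner_bdryChar_eq_zero_of_positiveProj s A e ν he
    ((M.mem_apsDomain s A ν).1 hx e)
  rw [trace_modeH1, inner_smul_right, mul_eq_zero] at h
  exact h.resolve_right (inner_self_ne_zero.2 (M.bdryChar_ne_zero s e n))

theorem diracAPS_injective (hA : ∀ n, s.freq n + A ≠ 0) {x : M.apsDomain s A ν}
    (hx : M.diracAPS s A ν x = 0) : x = 0 := by
  refine Subtype.ext (M.eq_zero_of_diracPlus_eq_zero s A hx fun n => ?_)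
  obtain ⟨e, he, -⟩ := M.exists_positive_end s A ν hA n
  exact ⟨e, M.inner_bdryChar_eq_zero_of_positiveProj s A e ν he
    ((M.mem_apsDomain s A ν).1 x.2 e)⟩

/-- The sections in the APS domain that consist of the `n`-th mode only. -/
def apsMode (n : ℤ) : Submodule ℂ (M.apsDomain s A ν) :=
  (LinearMap.range (M.modeH1 s n)).comap (M.apsDomain s A ν).subtype

/-- The mode equation can be solved for any continuous right side from initial value 0 at the
constrained end, and nothing is asked at the other end. So the range contains every real continuous
profile in every mode. -/
theorem apsMode_total (hA : ∀ n, s.freq n + A ≠ 0) {y : M.L2}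
    (hy : ∀ n, ∀ x ∈ M.apsMode s A ν n, inner ℂ (M.diracAPS s A ν x) y = 0) : y = 0 := by
  refine eq_zero_of_coef (s := s) fun n h hh => ?_
  obtain ⟨e, -, he⟩ := M.exists_positive_end s A ν hA n
  -- Division by `f` compensates the Riemannian density, so that the pairing is exactly the
  -- coefficient against `h`.
  have cg : Continuous fun t => (M.fExt t)⁻¹ * h t := M.continuous_inv_fExt.mul hh
  have cg' : Continuous fun t => (((M.fExt t)⁻¹ * h t : ℝ) : ℂ) := continuous_ofReal.comp cg
  obtain ⟨u, hu0, hu⟩ := exists_hasDerivAt_linear (M.continuous_modeCoeff s A n).neg cg'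
    (M.pos e) 0
  have cu : Continuous u := continuous_iff_continuousAt.2 fun t => (hu t).continuousAt
  have cu' : Continuous fun t => (-M.modeCoeff s A n) t • u t
      + (((M.fExt t)⁻¹ * h t : ℝ) : ℂ) :=
    ((M.continuous_modeCoeff s A n).neg.smul cu).add cg'
  let x : C1Pair := ⟨(⟨u, cu⟩, ⟨_, cu'⟩), hu⟩
  have hx : M.modeH1 s n x ∈ M.apsDomain s A ν := M.modeH1_mem_apsDomain s A ν he hu0
  have hD : M.modeDirac s A n x = ⟨_, cg'⟩ := by
    ext t
    simp only [modeDirac, modeP, x, ContinuousMap.add_apply, ContinuousMap.smul_apply,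
      ContinuousMap.mul_apply, ContinuousMap.coe_mk, Pi.neg_apply, modeCoeff, real_smul,
      smul_eq_mul]
    push_cast
    ring
  have h1 := hy n ⟨_, hx⟩ ⟨x, rfl⟩
  have h2 : M.diracAPS s A ν ⟨_, hx⟩ = I • M.modeL2 s n (M.modeDirac s A n x) :=
    M.diracPlus_modeH1 s A n x
  rw [h2, inner_smul_left, mul_eq_zero, hD, inner_modeL2_ofReal cg] at h1
  have h3 := h1.resolve_left (by simp)
  rw [← h3]
  congr 1
  ext t
  rw [mul_inv_cancel_left₀ (M.fExt_pos t).ne']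

theorem hasAdjointIndex_diracAPS (hA : ∀ n, s.freq n + A ≠ 0) :
    HasAdjointIndex (V := M.apsDomain s A ν) (H := M.L2) (M.diracAPS s A ν) 0 :=
  hasAdjointIndex_zero_of_injective _ (fun _ => M.diracAPS_injective s A ν hA) fun _ hy =>
    M.apsMode_total s A ν hA fun _ x _ => hy x

end WarpedCylinder

namespace WarpedCylinder

variable (M : WarpedCylinder) (s : SpinStructure) (A : ℝ)

/-! ## The energy identity and the surjectivity of the outward problem -/

/-- The interior suffices for the fundamental theorem of calculus; at the endpoints the constant
extension may have corners. -/
theorem hasDerivAt_fExt {t : ℝ} (ht : t ∈ Ioo 0 M.T) :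
    HasDerivAt M.fExt (2 * M.fExt t * M.aExt t) t := by
  have hI : t ∈ Icc 0 M.T := Ioo_subset_Icc_self ht
  have hn : Icc 0 M.T ∈ nhds t := Icc_mem_nhds ht.1 ht.2
  have h1 : HasDerivAt M.f (M.fDeriv t) t :=
    ((M.f_smooth.differentiableOn (by simp) t hI).hasDerivWithinAt).hasDerivAt hn
  have h2 : M.fExt =ᶠ[nhds t] M.f := Filter.eventually_of_mem hn fun r hr => fExt_eq hr
  refine (h1.congr_of_eventuallyEq h2).congr_deriv ?_
  have := (M.f_pos t hI).ne'
  rw [fExt_eq hI, aExt_eq hI]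
  field_simp

/-- The weight `f²` clears the denominator in `p + l u/f`. The cross term is `2 l f Re⟨u, p⟩ = l
(f|u|²)'`, since the `f'/2f` in `p` accounts for the derivative of `f`. -/
theorem energy_identity (n : ℤ) (x : C1Pair) :
    ∫ t in (0)..M.T, M.fExt t ^ 2 * ‖M.modeDirac s A n x t‖ ^ 2
      = (∫ t in (0)..M.T, M.fExt t ^ 2 * ‖M.modeP x t‖ ^ 2)
        + (s.freq n + A) ^ 2 * (∫ t in (0)..M.T, ‖x.1.1 t‖ ^ 2)
        + (s.freq n + A) * (M.f M.T * ‖x.1.1 M.T‖ ^ 2 - M.f 0 * ‖x.1.1 0‖ ^ 2) := by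
  set l : ℝ := s.freq n + A with hl
  obtain ⟨⟨u, h⟩, hu⟩ := x
  have hu' : ∀ t, HasDerivAt u (h t) t := hu
  set p : C(ℝ, ℂ) := M.modeP ⟨(u, h), hu⟩ with hp
  have hpt : ∀ t, p t = h t + (M.aExt t : ℂ) * u t := fun t => rfl
  have cF := M.continuous_fExt
  have c1 : Continuous fun t => M.fExt t ^ 2 * ‖p t‖ ^ 2 := by fun_prop
  have c2 : Continuous fun t => ‖u t‖ ^ 2 := by fun_prop
  have c3 : Continuous fun t => 2 * M.fExt t * inner ℝ (u t) (p t) :=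
    (continuous_const.mul cF).mul (u.continuous.inner p.continuous)
  have hend : ∫ t in (0)..M.T, 2 * M.fExt t * inner ℝ (u t) (p t)
      = M.f M.T * ‖u M.T‖ ^ 2 - M.f 0 * ‖u 0‖ ^ 2 := by
    rw [intervalIntegral.integral_eq_sub_of_hasDerivAt_of_le (f := fun t => M.fExt t * ‖u t‖ ^ 2)
      M.T_pos.le (cF.mul c2).continuousOn (fun t ht => ?_) (c3.intervalIntegrable _ _)]
    · rw [fExt_eq (t := 0) (M.pos_mem .left), fExt_eq (t := M.T) (M.pos_mem .right)]
    · refine ((M.hasDerivAt_fExt ht).mul (hu' t).norm_sq).congr_deriv ?_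
      rw [hpt, inner_add_right, ← real_smul, inner_smul_right, real_inner_self_eq_norm_sq]
      ring
  have hpoint : ∀ t, M.fExt t ^ 2 * ‖M.modeDirac s A n ⟨(u, h), hu⟩ t‖ ^ 2
      = (M.fExt t ^ 2 * ‖p t‖ ^ 2 + l ^ 2 * ‖u t‖ ^ 2)
        + l * (2 * M.fExt t * inner ℝ (u t) (p t)) := by
    intro t
    have hF := (M.fExt_pos t).ne'
    have e : M.modeDirac s A n ⟨(u, h), hu⟩ t = p t + (l * (M.fExt t)⁻¹) • u t := by
      simp only [modeDirac, ContinuousMap.add_apply, ContinuousMap.smul_apply,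
        ContinuousMap.mul_apply, ContinuousMap.coe_mk, smul_eq_mul, real_smul, ← hp, ← hl]
      push_cast
      ring
    rw [e, norm_add_sq_real, inner_smul_right, norm_smul, mul_pow, Real.norm_eq_abs, sq_abs,
      real_inner_comm]
    field_simp
    ring
  simp_rw [hpoint]
  have c2' : Continuous fun t => l ^ 2 * ‖u t‖ ^ 2 := continuous_const.mul c2
  have c3' : Continuous fun t => l * (2 * M.fExt t * inner ℝ (u t) (p t)) :=
    continuous_const.mul c3
  have c12 : Continuous fun t => M.fExt t ^ 2 * ‖p t‖ ^ 2 + l ^ 2 * ‖u t‖ ^ 2 := c1.add c2'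
  rw [intervalIntegral.integral_add (c12.intervalIntegrable _ _) (c3'.intervalIntegrable _ _),
    intervalIntegral.integral_add (c1.intervalIntegrable _ _) (c2'.intervalIntegrable _ _),
    intervalIntegral.integral_const_mul, intervalIntegral.integral_const_mul, hend]

/-! ### Estimates uniform in the mode -/

theorem exists_fExt_bounds : ∃ m K : ℝ, 0 < m ∧ 0 < K ∧ ∀ t, m ≤ M.fExt t ∧ M.fExt t ≤ K := by
  obtain ⟨t₀, ht₀, hmin⟩ := isCompact_Icc.exists_isMinOn (nonempty_Icc.2 M.T_pos.le)
    M.f_smooth.continuousOn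
  obtain ⟨t₁, ht₁, hmax⟩ := isCompact_Icc.exists_isMaxOn (nonempty_Icc.2 M.T_pos.le)
    M.f_smooth.continuousOn
  refine ⟨M.f t₀, M.f t₁, M.f_pos _ ht₀, M.f_pos _ ht₁, fun t => ?_⟩
  have := (projIcc 0 M.T M.T_pos.le t).2
  exact ⟨hmin this, hmax this⟩

/-- The boundary term in the energy identity controls the traces under the outward condition. -/
theorem le_boundary_term {n : ℤ} (hA : ∀ n, s.freq n + A ≠ 0) {x : C1Pair}
    (hx : M.modeH1 s n x ∈ M.apsDomain s A .outward) (e : Endpoint) :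
    |s.freq n + A| * (M.f (M.pos e) * ‖x.1.1 (M.pos e)‖ ^ 2)
      ≤ (s.freq n + A) * (M.f M.T * ‖x.1.1 M.T‖ ^ 2 - M.f 0 * ‖x.1.1 0‖ ^ 2) := by
  have h0 : 0 < M.f 0 := M.f_at_pos .left
  have h1 : 0 < M.f M.T := M.f_at_pos .right
  rcases lt_or_gt_of_ne (hA n) with h | h
  -- For `l < 0` the outward condition is `u(T) = 0`, and the surviving term `-l f(0)|u(0)|²` is
  -- nonnegative; for `l > 0` the ends exchange roles.
  · have hr : 0 < M.bdryEigenvalue s A .outward .right n :=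
      mul_pos_of_neg_of_neg (by simp [bdryFactor, normalCoeff, neg_div, pos, h1]) h
    have hu := M.eq_zero_of_modeH1_mem_apsDomain s A .outward hr hx
    rw [pos] at hu
    rw [abs_of_neg h, hu]
    cases e
    · rw [pos]
      exact le_of_eq (by simp; ring)
    · rw [pos, hu]
      have : 0 ≤ M.f 0 * ‖x.1.1 0‖ ^ 2 := by positivity
      simp
      nlinarith
  · have hl : 0 < M.bdryEigenvalue s A .outward .left n :=
      mul_pos (by simp [bdryFactor, normalCoeff, pos, h0]) h
    have hu := M.eq_zero_of_modeH1_mem_apsDomain s A .outward hl hx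
    rw [pos] at hu
    rw [abs_of_pos h, hu]
    cases e
    · rw [pos, hu]
      have : 0 ≤ M.f M.T * ‖x.1.1 M.T‖ ^ 2 := by positivity
      simp
      positivity
    · rw [pos]
      exact le_of_eq (by simp)

theorem norm_trace_modeH1_sq (e : Endpoint) (n : ℤ) (x : C1Pair) :
    ‖M.trace s e (M.modeH1 s n x)‖ ^ 2
      = 2 * Real.pi * (M.f (M.pos e) * ‖x.1.1 (M.pos e)‖ ^ 2) := by
  have h : ‖M.bdryChar s e n‖ ^ 2 = 2 * Real.pi * M.f (M.pos e) := by
    have := inner_self_eq_norm_sq_to_K (𝕜 := ℂ) (M.bdryChar s e n)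
    rw [inner_bdryChar_self] at this
    have h' : ((2 * Real.pi * M.f (M.pos e) : ℝ) : ℂ) = ((‖M.bdryChar s e n‖ ^ 2 : ℝ) : ℂ) := by
      rw [this]
      push_cast
      rfl
    exact_mod_cast h'.symm
  rw [trace_modeH1, norm_smul, mul_pow, h]
  ring

/-- The energy estimate for a single mode, in terms of norms on `M`. -/
theorem exists_energy_bound (hA : ∀ n, s.freq n + A ≠ 0) :
    ∃ K : ℝ, 0 ≤ K ∧ ∀ n x, M.modeH1 s n x ∈ M.apsDomain s A .outward →
      |s.freq n + A| * ‖M.modeL2 s n x.1.1‖ ≤ K * ‖M.modeL2 s n (M.modeDirac s A n x)‖ ∧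
      ‖M.modeL2 s n (M.modeP x)‖ ≤ K * ‖M.modeL2 s n (M.modeDirac s A n x)‖ ∧
      ∀ e, |s.freq n + A| * ‖M.trace s e (M.modeH1 s n x)‖ ^ 2
        ≤ K * ‖M.modeL2 s n (M.modeDirac s A n x)‖ ^ 2 := by
  obtain ⟨m, K, hm, hK, hF⟩ := M.exists_fExt_bounds
  -- `K` and `m` bound `f` and trade the weights `1`, `f` and `f²` for one another. The entry 1
  -- gives `C ≤ C²`, used when a bound on squares is turned into one on norms.
  refine ⟨max K (max (K / m) 1), by positivity, fun n x hx => ?_⟩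
  have hid := M.energy_identity s A n x
  have hb := M.le_boundary_term s A hA hx
  have hpi := Real.pi_pos
  have cF := M.continuous_fExt
  set l : ℝ := s.freq n + A
  set g := M.modeDirac s A n x
  set p := M.modeP x
  set u := x.1.1
  have mono : ∀ {a b : ℝ → ℝ}, Continuous a → Continuous b → (∀ t, a t ≤ b t) →
      ∫ t in (0)..M.T, a t ≤ ∫ t in (0)..M.T, b t := fun ha hb hab =>
    intervalIntegral.integral_mono_on M.T_pos.le (ha.intervalIntegrable _ _)
      (hb.intervalIntegrable _ _) fun t _ => hab t
  have i1 : ∫ t in (0)..M.T, M.fExt t ^ 2 * ‖g t‖ ^ 2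
      ≤ K * ∫ t in (0)..M.T, M.fExt t * ‖g t‖ ^ 2 := by
    rw [← intervalIntegral.integral_const_mul]
    refine mono (by fun_prop) (by fun_prop) fun t => ?_
    rw [sq (M.fExt t), mul_assoc]
    exact mul_le_mul_of_nonneg_right (hF t).2 (mul_nonneg (M.fExt_pos t).le (sq_nonneg _))
  have i2 : ∫ t in (0)..M.T, M.fExt t * ‖u t‖ ^ 2 ≤ K * ∫ t in (0)..M.T, ‖u t‖ ^ 2 := by
    rw [← intervalIntegral.integral_const_mul]
    exact mono (by fun_prop) (by fun_prop) fun t =>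
      mul_le_mul_of_nonneg_right (hF t).2 (sq_nonneg _)
  have i3 : m * ∫ t in (0)..M.T, M.fExt t * ‖p t‖ ^ 2
      ≤ ∫ t in (0)..M.T, M.fExt t ^ 2 * ‖p t‖ ^ 2 := by
    rw [← intervalIntegral.integral_const_mul]
    refine mono (by fun_prop) (by fun_prop) fun t => ?_
    rw [sq (M.fExt t), mul_assoc]
    exact mul_le_mul_of_nonneg_right (hF t).1 (mul_nonneg (M.fExt_pos t).le (sq_nonneg _))
  have n1 : 0 ≤ ∫ t in (0)..M.T, M.fExt t ^ 2 * ‖p t‖ ^ 2 :=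
    intervalIntegral.integral_nonneg M.T_pos.le fun t _ => by positivity
  have n2 : 0 ≤ ∫ t in (0)..M.T, ‖u t‖ ^ 2 :=
    intervalIntegral.integral_nonneg M.T_pos.le fun t _ => by positivity
  have n3 : ∀ e, 0 ≤ |l| * (M.f (M.pos e) * ‖u (M.pos e)‖ ^ 2) := fun e => by
    have := M.f_at_pos e
    positivity
  have n4 : 0 ≤ l ^ 2 * ∫ t in (0)..M.T, ‖u t‖ ^ 2 := by positivity
  have hu := M.norm_modeL2_sq s n u
  have hg := M.norm_modeL2_sq s n g
  have hp := M.norm_modeL2_sq s n p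
  set Iu := ∫ t in (0)..M.T, M.fExt t * ‖u t‖ ^ 2
  set Ig := ∫ t in (0)..M.T, M.fExt t * ‖g t‖ ^ 2
  set Ip := ∫ t in (0)..M.T, M.fExt t * ‖p t‖ ^ 2
  have hKK : K ≤ max K (max (K / m) 1) := le_max_left _ _
  have hKm : K / m ≤ max K (max (K / m) 1) := (le_max_left _ _).trans (le_max_right _ _)
  have hK1 : 1 ≤ max K (max (K / m) 1) := (le_max_right _ _).trans (le_max_right _ _)
  set C := max K (max (K / m) 1)
  have hC0 : 0 ≤ C := zero_le_one.trans hK1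
  have hb0 := (n3 .left).trans (hb .left)
  refine ⟨?_, ?_, fun e => ?_⟩
  · refine (le_of_sq_le_sq ?_ (by positivity) : _ ≤ K * ‖M.modeL2 s n g‖).trans
      (mul_le_mul_of_nonneg_right hKK (norm_nonneg _))
    rw [mul_pow, mul_pow, sq_abs, hu, hg]
    have h1 : l ^ 2 * (∫ t in (0)..M.T, ‖u t‖ ^ 2) ≤ K * Ig := by linarith
    calc l ^ 2 * (2 * Real.pi * Iu)
        ≤ l ^ 2 * (2 * Real.pi * (K * ∫ t in (0)..M.T, ‖u t‖ ^ 2)) := by gcongr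
      _ = 2 * Real.pi * K * (l ^ 2 * ∫ t in (0)..M.T, ‖u t‖ ^ 2) := by ring
      _ ≤ 2 * Real.pi * K * (K * Ig) := by gcongr
      _ = _ := by ring
  · refine le_of_sq_le_sq ?_ (by positivity)
    rw [mul_pow, hp, hg]
    have h1 : Ip ≤ K / m * Ig := by
      rw [div_mul_eq_mul_div, le_div_iff₀ hm]
      linarith
    have hIg : 0 ≤ Ig := intervalIntegral.integral_nonneg M.T_pos.le fun t _ =>
      mul_nonneg (M.fExt_pos t).le (sq_nonneg _)
    have h2 : Ip ≤ C ^ 2 * Ig := h1.trans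
      (mul_le_mul_of_nonneg_right (hKm.trans (by nlinarith)) hIg)
    calc 2 * Real.pi * Ip ≤ 2 * Real.pi * (C ^ 2 * Ig) := by gcongr
      _ = _ := by ring
  · rw [norm_trace_modeH1_sq, hg]
    have hIg : 0 ≤ Ig := intervalIntegral.integral_nonneg M.T_pos.le fun t _ =>
      mul_nonneg (M.fExt_pos t).le (sq_nonneg _)
    have h1 : |l| * (M.f (M.pos e) * ‖u (M.pos e)‖ ^ 2) ≤ C * Ig :=
      ((hb e).trans (by linarith)).trans (mul_le_mul_of_nonneg_right hKK hIg)
    calc |l| * (2 * Real.pi * (M.f (M.pos e) * ‖u (M.pos e)‖ ^ 2))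
        = 2 * Real.pi * (|l| * (M.f (M.pos e) * ‖u (M.pos e)‖ ^ 2)) := by ring
      _ ≤ 2 * Real.pi * (C * Ig) := by gcongr
      _ = _ := by ring

/-- On a single mode, the graph norm of the outward problem dominates the `H¹` norm. -/
theorem exists_mode_bound (hA : ∀ n, s.freq n + A ≠ 0) :
    ∃ C : ℝ, 0 ≤ C ∧ ∀ n x, M.modeH1 s n x ∈ M.apsDomain s A .outward →
      ‖M.incl s (M.modeH1 s n x)‖ ≤ C * ‖M.diracPlus s A (M.modeH1 s n x)‖ ∧
      ‖M.dt s (M.modeH1 s n x)‖ ≤ C * ‖M.diracPlus s A (M.modeH1 s n x)‖ ∧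
      ‖M.dθ s (M.modeH1 s n x)‖ ≤ C * ‖M.diracPlus s A (M.modeH1 s n x)‖ ∧
      ∀ e, ‖M.trace s e (M.modeH1 s n x)‖ ≤ C * ‖M.diracPlus s A (M.modeH1 s n x)‖ := by
  obtain ⟨K, hK, hbound⟩ := M.exists_energy_bound s A hA
  obtain ⟨δ, hδ, hgap⟩ := exists_gap s A hA
  set a : M.L2 →L[ℂ] M.L2 := M.mulCoeff (fun t => M.fDeriv t / (2 * M.f t))
    M.continuousOn_fDeriv_div with ha
  -- In order: the section, by the gap; `u' = p - (f'/2f) u`; `∂_θ`, by `abs_freq_le`; and the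
  -- traces, where `1 + K/δ` dominates the square root of `K/δ`.
  set C₁ := K / δ
  set C₂ := K + ‖a‖ * (K / δ)
  set C₃ := (1 + |A| / δ) * K
  set C₄ := 1 + K / δ
  have p1 : 0 ≤ C₁ := by positivity
  have p2 : 0 ≤ C₂ := by positivity
  have p3 : 0 ≤ C₃ := by positivity
  have p4 : 1 ≤ C₄ := by simp only [C₄]; linarith
  refine ⟨C₁ + C₂ + C₃ + C₄, by linarith, fun n x hx => ?_⟩
  obtain ⟨hu, hp, htr⟩ := hbound n x hx
  have hD : ‖M.diracPlus s A (M.modeH1 s n x)‖ = ‖M.modeL2 s n (M.modeDirac s A n x)‖ := by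
    rw [diracPlus_modeH1, norm_smul, norm_I, one_mul]
  rw [hD]
  set N := ‖M.modeL2 s n (M.modeDirac s A n x)‖
  have hN : 0 ≤ N := norm_nonneg _
  have weaken : ∀ {y c : ℝ}, y ≤ c * N → c ≤ C₁ + C₂ + C₃ + C₄ →
      y ≤ (C₁ + C₂ + C₃ + C₄) * N := fun h1 h2 => h1.trans (mul_le_mul_of_nonneg_right h2 hN)
  have hu1 : ‖M.modeL2 s n x.1.1‖ ≤ C₁ * N := by
    rw [div_mul_eq_mul_div, le_div_iff₀ hδ, mul_comm]
    exact (mul_le_mul_of_nonneg_right (hgap n) (norm_nonneg _)).trans hu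
  refine ⟨weaken hu1 (by linarith), weaken (c := C₂) ?_ (by linarith),
    weaken (c := C₃) ?_ (by linarith), fun e => weaken (c := C₄) ?_ (by linarith)⟩
  · have e : M.dt s (M.modeH1 s n x) = M.modeL2 s n (M.modeP x) - a (M.modeL2 s n x.1.1) := by
      rw [dt_modeH1, ha, M.mulCoeff_modeL2 s M.continuousOn_fDeriv_div M.continuous_aExt
        (fun t ht => aExt_eq ht), modeP, map_add, add_sub_cancel_right]
    calc _ ≤ ‖M.modeL2 s n (M.modeP x)‖ + ‖a (M.modeL2 s n x.1.1)‖ := e ▸ norm_sub_le _ _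
      _ ≤ K * N + ‖a‖ * (C₁ * N) := add_le_add hp ((a.le_opNorm _).trans
          (mul_le_mul_of_nonneg_left hu1 (norm_nonneg _)))
      _ = C₂ * N := by simp only [C₁, C₂]; ring
  · rw [dθ_modeH1, norm_smul, norm_mul, norm_I, one_mul, norm_real, Real.norm_eq_abs]
    calc _ ≤ (1 + |A| / δ) * |s.freq n + A| * ‖M.modeL2 s n x.1.1‖ :=
          mul_le_mul_of_nonneg_right (abs_freq_le s A hδ n (hgap n)) (norm_nonneg _)
      _ = (1 + |A| / δ) * (|s.freq n + A| * ‖M.modeL2 s n x.1.1‖) := by ring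
      _ ≤ (1 + |A| / δ) * (K * N) := by gcongr
      _ = C₃ * N := by simp only [C₃]; ring
  · refine le_of_sq_le_sq ?_ (by positivity)
    have h1 : ‖M.trace s e (M.modeH1 s n x)‖ ^ 2 ≤ K / δ * N ^ 2 := by
      rw [div_mul_eq_mul_div, le_div_iff₀ hδ, mul_comm]
      exact (mul_le_mul_of_nonneg_right (hgap n) (sq_nonneg _)).trans (htr e)
    rw [mul_pow]
    exact h1.trans (mul_le_mul_of_nonneg_right (by simp only [C₄] at *; nlinarith) (sq_nonneg _))

instance (ν : NormalConvention) : CompleteSpace (M.apsDomain s A ν) := by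
  have h : ∀ e, IsClosed (M.apsCondition s A ν e : Set (M.H1 s)) := fun e =>
    ContinuousLinearMap.isClosed_ker _
  exact ((h .left).inter (h .right)).completeSpace_coe

/-- The mode bounds are summed separately for the section, its two derivatives and its two traces,
each of which sends distinct modes to orthogonal vectors. With `apsMode_total` this is the input of
`exists_preimage_of_total`. -/
theorem diracAPS_outward_surjective (hA : ∀ n, s.freq n + A ≠ 0) :
    Function.Surjective (M.diracAPS s A .outward) := by
  obtain ⟨C, hC, hbound⟩ := M.exists_mode_bound s A hA
  have sub : ∀ {n} {x : M.apsDomain s A .outward}, x ∈ M.apsMode s A .outward n →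
      ∃ z : C1Pair, (x : M.H1 s) = M.modeH1 s n z ∧ M.modeH1 s n z ∈ M.apsDomain s A .outward := by
    rintro n x ⟨z, hz⟩
    exact ⟨z, hz.symm, hz ▸ x.2⟩
  intro y
  suffices bound : ∀ (S : Finset ℤ) (x : ℤ → M.apsDomain s A .outward),
      (∀ n, x n ∈ M.apsMode s A .outward n) →
        ‖∑ n ∈ S, x n‖ ≤ C * ‖M.diracAPS s A .outward (∑ n ∈ S, x n)‖ by
    obtain ⟨x, hx, -⟩ := exists_preimage_of_total (ι := ℤ) (V := M.apsDomain s A .outward)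
      (H := M.L2) (M.diracAPS s A .outward) (M.apsMode s A .outward) hC bound
      (fun z hz => M.apsMode_total s A .outward hA hz) y
    exact ⟨x, hx⟩
  intro S x hxm
  choose z hz hzm using fun n => sub (hxm n)
  have hDx : ∀ n, M.diracAPS s A .outward (x n) = I • M.modeL2 s n (M.modeDirac s A n (z n)) :=
    fun n => (congrArg (M.diracPlus s A) (hz n)).trans (M.diracPlus_modeH1 s A n (z n))
  have hDn : ∀ n, ‖M.diracPlus s A (M.modeH1 s n (z n))‖ = ‖M.diracAPS s A .outward (x n)‖ :=
    fun n => by rw [← hz n]; rfl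
  have orth : ∀ n m, n ≠ m → ∀ (a b : ℂ) (g h : C(ℝ, ℂ)),
      inner ℂ (a • M.modeL2 s n g) (b • M.modeL2 s m h) = 0 := by
    intro n m hnm a b g h
    rw [inner_smul_left, inner_smul_right, M.inner_modeL2_of_ne s hnm, mul_zero, mul_zero]
  have hD : ∀ n m, n ≠ m →
      inner ℂ (M.diracAPS s A .outward (x n)) (M.diracAPS s A .outward (x m)) = 0 := by
    intro n m hnm
    rw [hDx, hDx, orth n m hnm]
  let ι := (M.apsDomain s A .outward).subtypeL
  have b1 := norm_map_sum_le_of_orthogonal ((M.incl s).comp ι) (M.diracAPS s A .outward) hC S x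
    (fun n m hnm => by
      change inner ℂ (M.incl s (x n)) (M.incl s (x m)) = 0
      rw [hz, hz, incl_modeH1, incl_modeH1, M.inner_modeL2_of_ne s hnm]) hD fun n => by
      have := (hbound n (z n) (hzm n)).1
      rwa [hDn, ← hz] at this
  have b2 := norm_map_sum_le_of_orthogonal ((M.dt s).comp ι) (M.diracAPS s A .outward) hC S x
    (fun n m hnm => by
      change inner ℂ (M.dt s (x n)) (M.dt s (x m)) = 0
      rw [hz, hz, dt_modeH1, dt_modeH1, M.inner_modeL2_of_ne s hnm]) hD fun n => by
      have := (hbound n (z n) (hzm n)).2.1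
      rwa [hDn, ← hz] at this
  have b3 := norm_map_sum_le_of_orthogonal ((M.dθ s).comp ι) (M.diracAPS s A .outward) hC S x
    (fun n m hnm => by
      change inner ℂ (M.dθ s (x n)) (M.dθ s (x m)) = 0
      rw [hz, hz, dθ_modeH1, dθ_modeH1, orth n m hnm]) hD fun n => by
      have := (hbound n (z n) (hzm n)).2.2.1
      rwa [hDn, ← hz] at this
  have b4 := fun e => norm_map_sum_le_of_orthogonal ((M.trace s e).comp ι)
    (M.diracAPS s A .outward) hC S x
    (fun n m hnm => by
      change inner ℂ (M.trace s e (x n)) (M.trace s e (x m)) = 0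
      rw [hz, hz, trace_modeH1, trace_modeH1, inner_smul_left, inner_smul_right,
        M.inner_bdryChar_of_ne s e hnm, mul_zero, mul_zero]) hD fun n => by
      have := (hbound n (z n) (hzm n)).2.2.2 e
      rwa [hDn, ← hz] at this
  -- The norm on `H¹(M)` is the maximum of the norms of these five components.
  exact max_le b1 (max_le b2 (max_le b3 (max_le (b4 .left) (b4 .right))))

theorem isFredholmOfIndex_diracAPS_outward (hA : ∀ n, s.freq n + A ≠ 0) :
    IsFredholmOfIndex (V := M.apsDomain s A .outward) (W := M.L2) (M.diracAPS s A .outward) 0 :=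
  isFredholmOfIndex_zero_of_bijective _ ⟨(injective_iff_map_eq_zero _).2 fun _ =>
    M.diracAPS_injective s A .outward hA, M.diracAPS_outward_surjective s A hA⟩

end WarpedCylinder

end

/-! ### The theorem -/

theorem proposition4p2 (M : WarpedCylinder) (s : SpinStructure) (A : ℝ)
    (hA : ∀ k ∈ s.modes, k + A ≠ 0) :
    (∀ ν : NormalConvention,
      (∀ e : Endpoint, IsInvertibleOp (M.bdryIncl s e) (M.boundaryPlus s A ν e)) ∧
      (∃ ξ₀ ξT : ℂ,
        HasReducedEta (M.bdryIncl s .left) (M.boundaryPlus s A ν .left) ξ₀ ∧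
        HasReducedEta (M.bdryIncl s .right) (M.boundaryPlus s A ν .right) ξT ∧
        ξ₀ + ξT = 0) ∧
      HasAdjointIndex (V := M.apsDomain s A ν) (H := M.L2) (M.diracAPS s A ν) 0) ∧
    IsFredholmOfIndex (V := M.apsDomain s A .outward) (W := M.L2) (M.diracAPS s A .outward) 0 := by
  have hA' : ∀ n, s.freq n + A ≠ 0 := fun n => hA _ (s.freq_mem_modes n)
  refine ⟨fun ν => ⟨fun e => M.isInvertibleOp_boundaryPlus s A e ν hA',
    ⟨_, _, M.hasReducedEta_boundaryPlus s A .left ν hA',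
      M.hasReducedEta_boundaryPlus s A .right ν hA', ?_⟩,
    M.hasAdjointIndex_diracAPS s A ν hA'⟩, M.isFredholmOfIndex_diracAPS_outward s A hA'⟩
  rw [← add_div, M.etaFunction_add_etaFunction s A ν, zero_div]
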